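/- **Setting.** Let $\mathcal A$ be a set of $k\ge 1$ actions and let $P(a\succ b)\in[0,1]$, with $P(a\succ b)+P(b\succ a)=1$, be the probability that $a$ beats $b$ in a duel. Assume that there is a Condorcet winner $a_\star$, i.e. $P(a_\star\succ a)>1/2$ for all $a\ne a_\star$, and put $\tilde\Delta_a=P(a_\star\succ a)-1/2$. Let $G$ be a connected graph on $m$ agents with graph distance $d_{vw}$. In every round each agent plays an ordered pair of actions and observes the outcome of their duel; given the pairs played, the outcomes are independent with the above probabilities. The group regret after $n$ rounds is $$R_G(n)=\sum_{(a,b)\in\mathcal A\times\mathcal A}\frac{\tilde\Delta_a+\tilde\Delta_b}{2}\;\mathbb E\Big[\sum_{w}T_{(a,b),w}(n)\Big],$$ where $T_{(a,b),w}(n)$ is the number of rounds $t\le n$ in which agent $w$ plays the pair $(a,b)$. **QuACK with leader $v$ and single-agent algorithm $\pi$.** The leader keeps a first-in-first-out queue of outcomes for each ordered pair, all initially empty. In round $t$ it appends to the queues the pairs and outcomes of the followers $w\neq v$ from round $t-d_{vw}$; it then lets $\pi$ select a pair and, as long as the queue of the selected pair is non-empty, removes an outcome from this queue, updates $\pi$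 with it and lets $\pi$ select again. It plays the first selected pair whose queue is empty, and updates $\pi$ with the observed outcome. In round $t$ a follower $w$ plays the pair that the leader played in round $t-d_{vw}$ if $t>d_{vw}$, and a uniformly random pair otherwise. **RUCB with parameter $\alpha>1/2$.** Let $w_{ij}$ be the number of duels in which $i$ has beaten $j$ (initially $0$) and let $B=\emptyset$ initially. In step $t=1,2,\dots$ put $u_{ij}=\frac{w_{ij}}{w_{ij}+w_{ji}}+\sqrt{\frac{\alpha\ln t}{w_{ij}+w_{ji}}}$ for $i\neq j$ (with $x/0:=1$) and $u_{ii}=1/2$, and let $C=\{c: u_{cj}\ge 1/2\ \forall j\}$. Replace $B$ by $B\cap C$, and by $C$ if $|C|=1$. If $C=\emptyset$, pick $c\in\mathcal A$ uniformly; if $|C|=1$, let $c$ be its element; otherwise pick $c$ uniformly from $C$ if $B=\emptyset$, and if $B=\{b\}$ pick $c=b$ with probability $1/2$ and uniformly from $C\setminus\{b\}$ with probability $1/2$. Then pick $d$ uniformly among the maximisers of $j\mapsto u_{jc}$ (excluding $c$ if there is more than one), and compare the pair $(c,d)$. **Statement.** For all $k\ge1$, $\alpha>1/2$ and $\rho\in\mathbb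 R$ there is a constant $C=C(k,\alpha,\rho)>0$ such that, for every such preference matrix with Condorcet winner $a_\star$ and $\tilde\Delta_a\le\rho\,\tilde\Delta_b$ for all $a,b\neq a_\star$, every $m$, every connected graph $G$ on $m$ agents, every leader $v$ and every $n$ with $mn\ge 2$, QuACK with leader $v$ following RUCB satisfies $$R_G(n)\;\le\; C\left(\sum_{a\ne a_\star}\frac{\ln(mn)}{\tilde\Delta_a}+\Big(\sum_{w}d_{vw}\Big)\sum_{a\neq a_\star}\tilde\Delta_a\right).$$ That is, $R_G(n)=\mathcal O\big(\sum_{a\neq a_\star}\ln(mn)/\tilde\Delta_a+(\sum_w d_{vw})\sum_{a\ne a_\star}\tilde\Delta_a\big)$, where the hidden constant depends only on the number of actions, on $\alpha$ and on the ratio of the largest to the smallest gap, and not on the network, the leader, the horizon or the scale of the gaps. -/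

import Mathlib

open scoped ENNReal BigOperators

noncomputable section

namespace Duel

/-! ## Duelling bandits -/

/-- A preference matrix on the set of actions `A`: `P.prob a b` is the probability that `a` beats
`b` in a duel. -/
structure PreferenceMatrix (A : Type) where
  prob : A → A → ℝ
  prob_nonneg : ∀ a b, 0 ≤ prob a b
  prob_add : ∀ a b, prob a b + prob b a = 1

namespace PreferenceMatrix

variable {A : Type}

/-- `a` is the Condorcet winner: it beats every other action with probability above `1/2`. -/
def IsCondorcetWinner (P : PreferenceMatrix A) (a : A) : Prop :=
  ∀ b, b ≠ a → 1 / 2 < P.prob a b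

/-- The gap of `b` relative to `a`, namely `P(a ≻ b) - 1/2`. -/
def gap (P : PreferenceMatrix A) (a b : A) : ℝ := P.prob a b - 1 / 2

/-- The gap of a pair of actions, that is the regret of one duel: the average of the gaps of the
two actions. -/
def pairGap (P : PreferenceMatrix A) (a : A) (e : A × A) : ℝ :=
  (P.gap a e.1 + P.gap a e.2) / 2

/-- The law of the outcome of a duel; `true` means that the first action of the pair wins. -/
def duel (P : PreferenceMatrix A) (e : A × A) : PMF Bool :=
  PMF.ofFintype
    (fun x => if x then ENNReal.ofReal (P.prob e.1 e.2) else ENNReal.ofReal (P.prob e.2 e.1)) (by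
      simp only [Fintype.sum_bool, if_true, Bool.false_eq_true, if_false]
      rw [← ENNReal.ofReal_add (P.prob_nonneg _ _) (P.prob_nonneg _ _), P.prob_add,
        ENNReal.ofReal_one])

end PreferenceMatrix

/-! ## Single-agent algorithms -/

/-- A (randomised) single-agent algorithm for duelling bandits, as a machine with an internal
state. `select` draws the pair to be compared next and may change the internal state; `update`
feeds the outcome of the duel of a pair back to the algorithm. -/
structure Algorithm (A : Type) where
  State : Type
  init : State
  select : State → PMF ((A × A) × State)
  update : State → A × A → Bool → State

/-- Uniform choice from the finite set `s`, or from all of `A` if `s` is empty. -/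
def uniformOrAll {A : Type} [Fintype A] [Nonempty A] (s : Finset A) : PMF A :=
  if h : s.Nonempty then PMF.uniformOfFinset s h else PMF.uniformOfFintype A

/-! ## Relative upper confidence bound (RUCB) -/

namespace RUCB

/-- Division with the convention `x / 0 = 1`. -/
def divOne (x y : ℝ) : ℝ := if y = 0 then 1 else x / y

/-- The memory of RUCB: the number `wins i j` of duels in which `i` has beaten `j`, the
hypothesised best arm (the set `B`, which has at most one element), and the number of
completed rounds. -/
structure Memory (A : Type) where
  wins : A → A → ℕ
  best : Option A
  rounds : ℕ

variable {A : Type}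

/-- The optimistic estimate `u i j` of the probability that `i` beats `j`, in round
`t = rounds + 1`. -/
def ucb [DecidableEq A] (α : ℝ) (M : Memory A) (i j : A) : ℝ :=
  if i = j then 1 / 2
  else
    divOne (M.wins i j) (M.wins i j + M.wins j i) +
      √(divOne (α * Real.log (M.rounds + 1)) (M.wins i j + M.wins j i))

/-- The potential champions: the arms `c` with `u c j ≥ 1/2` for all `j`. -/
def candidates [Fintype A] [DecidableEq A] (α : ℝ) (M : Memory A) : Finset A :=
  open Classical in Finset.univ.filter fun c => ∀ j, 1 / 2 ≤ ucb α M c j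

/-- The arms maximising `u j c`. -/
def maximisers [Fintype A] [DecidableEq A] (α : ℝ) (M : Memory A) (c : A) : Finset A :=
  open Classical in Finset.univ.filter fun d => ∀ j, ucb α M j c ≤ ucb α M d c

/-- The hypothesised best arm after it has been updated with the candidate set `C`: if `C` is a
singleton it becomes the element of `C`, and otherwise it is dropped if it is not in `C`. -/
def newBest [DecidableEq A] (best : Option A) (C : Finset A) : Option A :=
  if h : C.card = 1 then some (Finset.card_pos.mp (h ▸ Nat.one_pos)).choose
  else best.filter fun b => b ∈ C

/-- The choice of the champion `c`, given the candidate set and the updated best arm. If there is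
at most one candidate there is nothing to weigh: `c` is the single candidate, or any arm
uniformly at random if there is no candidate. Otherwise the best arm, if there is one, gets
probability `1/2` and the remaining candidates share the rest equally. -/
def champion [Fintype A] [DecidableEq A] [Nonempty A] (C : Finset A) (best : Option A) : PMF A :=
  if C.card ≤ 1 then uniformOrAll C
  else
    match best with
    | none => uniformOrAll C
    | some b =>
      (PMF.uniformOfFintype Bool).bind fun coin =>
        if coin then PMF.pure b else uniformOrAll (C.erase b)

/-- The choice of the challenger `d`: a maximiser of `u d c`, ties being broken uniformly at
random; if there is a tie, `d` is not allowed to be `c`. -/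
def challenger [Fintype A] [DecidableEq A] [Nonempty A] (α : ℝ) (M : Memory A) (c : A) : PMF A :=
  if (maximisers α M c).card ≤ 1 then uniformOrAll (maximisers α M c)
  else uniformOrAll ((maximisers α M c).erase c)

end RUCB

/-- The relative upper confidence bound algorithm with exploration parameter `α`. -/
def rucb (A : Type) [Fintype A] [DecidableEq A] [Nonempty A] (α : ℝ) : Algorithm A where
  State := RUCB.Memory A
  init := { wins := fun _ _ => 0, best := none, rounds := 0 }
  select M :=
    let C := RUCB.candidates α M
    let best := RUCB.newBest M.best C
    (RUCB.champion C best).bind fun c =>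
      (RUCB.challenger α M c).bind fun d =>
        PMF.pure ((c, d), { M with best := best })
  update M e x :=
    { M with
      wins := fun i j =>
        M.wins i j + if (i, j) = (if x then (e.1, e.2) else (e.2, e.1)) then 1 else 0
      rounds := M.rounds + 1 }

/-! ## QuACK for duelling bandits -/

/-- Independent draws, one from each `f i`. -/
def indep {ι β : Type} [Fintype ι] [DecidableEq ι] [Fintype β] (f : ι → PMF β) : PMF (ι → β) :=
  PMF.ofFintype (fun g => ∏ i, f i (g i)) (by
    have h := Fintype.prod_sum (fun i b => f i b)
    rw [← h]
    refine Finset.prod_eq_one fun i _ => ?_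
    rw [← tsum_fintype (L := .unconditional _)]
    exact (f i).tsum_coe)

variable {A : Type} [Fintype A] [DecidableEq A]

/-- One queue of unused duel outcomes for each ordered pair of actions. -/
abbrev Queues (A : Type) : Type := A × A → List Bool

/-- What happened to the agents in one round: the pair that each agent played, with the outcome
of the duel. -/
abbrev Record (A : Type) (m : ℕ) : Type := Fin m → (A × A) × Bool

/-- The state of the network between two rounds: the queues of the leader, the internal state of
the leader's algorithm, and the records of all completed rounds, the most recent one first. -/
structure Network (π : Algorithm A) (m : ℕ) where
  queues : Queues A
  alg : π.State
  log : List (Record A m)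

/-- The leader's loop. Select a pair; while its queue is non-empty, remove the oldest outcome from
that queue, update the algorithm with it, and select again. Returns the first selected pair whose
queue is empty, the state of the algorithm, and the remaining queues. -/
def leaderLoop {A : Type} [Fintype A] [DecidableEq A] (π : Algorithm A) (st : π.State)
    (Q : Queues A) : PMF ((A × A) × π.State × Queues A) :=
  (π.select st).bind fun s =>
    match h : Q s.1 with
    | [] => PMF.pure (s.1, s.2, Q)
    | x :: xs => leaderLoop π (π.update s.2 s.1 x) (Function.update Q s.1 xs)
termination_by ∑ e, (Q e).length
decreasing_by
  refine Finset.sum_lt_sum (fun e _ => ?_) ⟨s.1, Finset.mem_univ _, ?_⟩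
  · by_cases he : e = s.1
    · subst he; simp [h]
    · simp [Function.update_of_ne he]
  · simp [h]

variable {m : ℕ} {π : Algorithm A}

/-- The record of the round that took place `d ≥ 1` rounds before the one about to be played,
if there was such a round. -/
def Network.ago (s : Network π m) (d : ℕ) : Option (Record A m) := s.log[d - 1]?

/-- The messages that reach the leader `v` at the start of the round: the pair played by each
follower `w` exactly `G.dist v w` rounds ago, with the outcome. -/
def Network.messages (G : SimpleGraph (Fin m)) (v : Fin m) (s : Network π m) :
    List ((A × A) × Bool) :=
  (List.finRange m).filterMap fun w =>
    if w = v then none else (s.ago (G.dist v w)).map fun r => r w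

/-- The queues after the messages have been appended. -/
def Network.received (G : SimpleGraph (Fin m)) (v : Fin m) (s : Network π m) : Queues A :=
  fun e => s.queues e ++ ((s.messages G v).filter fun x => x.1 = e).map fun x => x.2

/-- The pair that agent `w` plays in the round about to be played, when the leader `v` plays `e`:
a follower copies the pair that the leader played `G.dist v w` rounds ago, and as long as there
is no such round it plays a uniformly random pair. -/
def Network.play [Nonempty A] (G : SimpleGraph (Fin m)) (v : Fin m) (s : Network π m) (e : A × A)
    (w : Fin m) : PMF (A × A) :=
  if w = v then PMF.pure e
  else
    match s.ago (G.dist v w) with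
    | some r => PMF.pure (r v).1
    | none => PMF.uniformOfFintype (A × A)

/-- One round of QuACK on the graph `G` with leader `v`: the leader receives its messages and runs
its loop, all agents play and observe independent duels, and the leader updates its algorithm
with its own observation. -/
def quackRound [Nonempty A] (P : PreferenceMatrix A) (G : SimpleGraph (Fin m)) (v : Fin m)
    (s : Network π m) : PMF (Network π m) :=
  (leaderLoop π s.alg (s.received G v)).bind fun l =>
    (indep fun w => (s.play G v l.1 w).bind fun e => (P.duel e).map fun x => (e, x)).bind fun r =>
      PMF.pure
        { queues := l.2.2
          alg := π.update l.2.1 l.1 (r v).2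
          log := r :: s.log }

/-- The law of the state of the network after `n` rounds of QuACK, all queues being empty at the
start. -/
def quack [Nonempty A] (π : Algorithm A) (P : PreferenceMatrix A) (G : SimpleGraph (Fin m))
    (v : Fin m) : ℕ → PMF (Network π m)
  | 0 => PMF.pure { queues := fun _ => [], alg := π.init, log := [] }
  | n + 1 => (quack π P G v n).bind (quackRound P G v)

/-- The number of completed rounds in which agent `w` has played the pair `e`. -/
def Network.plays (s : Network π m) (e : A × A) (w : Fin m) : ℕ :=
  s.log.countP fun r => (r w).1 = e

/-- The group regret of QuACK after `n` rounds, relative to the action `a`: the sum over all pairs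
of the gap of the pair times the expected number of plays of the pair by the whole network. -/
def groupRegret [Nonempty A] (π : Algorithm A) (P : PreferenceMatrix A) (a : A)
    (G : SimpleGraph (Fin m)) (v : Fin m) (n : ℕ) : ℝ≥0∞ :=
  ∑ e : A × A, ENNReal.ofReal (P.pairGap a e) *
    ∑' s : Network π m, quack π P G v n s * ((∑ w, s.plays e w : ℕ) : ℝ≥0∞)

end Duel

end

/-! The network is compared with one run of RUCB for `m * n` steps; only the delays are lost.

The comparison works for any algorithm. An outcome that waits in a queue or is still under way
influences nothing until the algorithm reads it, because plays depend on earlier plays and on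
selections only. It can therefore be drawn at the moment of reading; `quack_map_core` states this as
an equality of laws with a lazy network. There the algorithm reads fresh independent outcomes,
exactly as in a single run. Each round adds at most `m` of them (at most `m - 1` arrivals and the
leader's own), so a quantity that grows in expectation is at most what it is after `m * n`
single-agent steps (`ev_lazyQuack_le`). On the other hand, the leader plays a pair only after using
every outcome of it that has arrived. Hence the network's plays of a pair exceed the used outcomes
of that pair by at most three times the sum of the delays (`LazyNetwork.Valid.sum_count_le`).
Together these give `ev_plays_le`.

For RUCB itself, let `Δ` be the smallest gap. While all estimates `u a j` of the Condorcet winner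
`a` are optimistic, every selected pair other than `(a, a)` satisfies `u i j + u j i ≥ 1 + Δ`, which
forces at most `4 α ln t / Δ²` earlier duels. An exponential supermartingale with geometric peeling
over the number of duels bounds the probability of failure at time `t` by a multiple of `(1 + ln t)
t ^ (-q)`, where `q` can be taken above `1` because `α > 1/2`. This is summable, so the expected
number of failures is bounded by a constant that depends on `α` alone.

The regret bound follows on multiplying by the pair gaps: a gap is at most `|ρ| Δ`, which turns `1 /
Δ²` into `1 / Δ`, and `ln (m n) / Δ` is bounded below and absorbs the constants. -/

set_option linter.unusedSectionVars false

noncomputable section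

namespace Duel

/-! ## Expectations and products of probability mass functions -/

section Expectation

variable {X Y : Type}

/-- The expectation of `f` under `p`. -/
def ev (p : PMF X) (f : X → ℝ≥0∞) : ℝ≥0∞ := ∑' x, p x * f x

theorem ev_pure (x : X) (f : X → ℝ≥0∞) : ev (PMF.pure x) f = f x := by
  classical
  unfold ev
  rw [tsum_eq_single x]
  · simp
  · intro y hy
    simp [PMF.pure_apply, hy]

theorem ev_bind (p : PMF X) (q : X → PMF Y) (f : Y → ℝ≥0∞) :
    ev (p.bind q) f = ev p fun x => ev (q x) f := by
  unfold ev
  simp only [PMF.bind_apply, ← ENNReal.tsum_mul_right, ← ENNReal.tsum_mul_left]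
  rw [ENNReal.tsum_comm]
  simp only [mul_assoc]

theorem ev_map (p : PMF X) (g : X → Y) (f : Y → ℝ≥0∞) : ev (p.map g) f = ev p fun x => f (g x) := by
  rw [PMF.map, ev_bind]
  simp [Function.comp, ev_pure]

theorem ev_mono_support (p : PMF X) {f g : X → ℝ≥0∞} (h : ∀ x ∈ p.support, f x ≤ g x) :
    ev p f ≤ ev p g := by
  refine ENNReal.tsum_le_tsum fun x => ?_
  by_cases hx : p x = 0
  · simp [hx]
  · gcongr
    exact h x ((PMF.mem_support_iff _ _).2 hx)

theorem ev_mono (p : PMF X) {f g : X → ℝ≥0∞} (h : ∀ x, f x ≤ g x) : ev p f ≤ ev p g :=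
  ev_mono_support p fun x _ => h x

theorem ev_const (p : PMF X) (c : ℝ≥0∞) : ev p (fun _ => c) = c := by
  simp [ev, ENNReal.tsum_mul_right, p.tsum_coe]

theorem ev_add (p : PMF X) (f g : X → ℝ≥0∞) : ev p (fun x => f x + g x) = ev p f + ev p g := by
  simp [ev, mul_add, ENNReal.tsum_add]

theorem ev_mul_left (p : PMF X) (c : ℝ≥0∞) (f : X → ℝ≥0∞) :
    ev p (fun x => c * f x) = c * ev p f := by
  simp [ev, ← ENNReal.tsum_mul_left, mul_left_comm]

theorem ev_sum {ι : Type} (p : PMF X) (s : Finset ι) (f : ι → X → ℝ≥0∞) :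
    ev p (fun x => ∑ i ∈ s, f i x) = ∑ i ∈ s, ev p (f i) := by
  classical
  induction s using Finset.induction_on with
  | empty => simp [ev]
  | insert i s hi ih => simp [Finset.sum_insert hi, ev_add, ih]

theorem ev_le_of_support (p : PMF X) {f : X → ℝ≥0∞} {c : ℝ≥0∞} (h : ∀ x ∈ p.support, f x ≤ c) :
    ev p f ≤ c :=
  (ev_mono_support p h).trans (ev_const p c).le

theorem bind_congr_support (p : PMF X) {f g : X → PMF Y} (h : ∀ x ∈ p.support, f x = g x) :
    p.bind f = p.bind g := by
  ext y
  simp only [PMF.bind_apply]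
  refine tsum_congr fun x => ?_
  by_cases hx : p x = 0
  · simp [hx]
  · rw [h x ((PMF.mem_support_iff _ _).2 hx)]

end Expectation

section Product

variable {β γ : Type}

/-- Independent draws, one from each `f i`. -/
def piPMF : {n : ℕ} → (Fin n → PMF β) → PMF (Fin n → β)
  | 0, _ => PMF.pure Fin.elim0
  | _ + 1, f => (f 0).bind fun x => (piPMF fun i => f i.succ).bind fun y =>
      PMF.pure (Fin.cons x y)

theorem piPMF_pure {n : ℕ} (g : Fin n → β) : piPMF (fun i => PMF.pure (g i)) = PMF.pure g := by
  induction n with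
  | zero => simp only [piPMF]; congr 1; exact Subsingleton.elim _ _
  | succ n ih =>
    simp only [piPMF, PMF.pure_bind, ih fun i => g i.succ]
    congr 1
    exact Fin.cons_self_tail g

theorem piPMF_bind {n : ℕ} (f : Fin n → PMF β) (g : Fin n → β → PMF γ) :
    piPMF (fun i => (f i).bind (g i)) = (piPMF f).bind fun x => piPMF fun i => g i (x i) := by
  induction n with
  | zero => simp [piPMF]
  | succ n ih =>
    simp only [piPMF, PMF.bind_bind, PMF.pure_bind, ih, Fin.cons_zero, Fin.cons_succ]
    refine congrArg (PMF.bind (f 0)) (funext fun x => ?_)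
    rw [PMF.bind_comm]

theorem piPMF_bind_pure {n : ℕ} (f : Fin n → PMF β) (g : Fin n → β → γ) :
    piPMF (fun i => (f i).bind fun x => PMF.pure (g i x)) =
      (piPMF f).bind fun x => PMF.pure fun i => g i (x i) := by
  rw [piPMF_bind]
  simp only [piPMF_pure]

/-- Drawing one coordinate again does not change the law. -/
theorem piPMF_resample {n : ℕ} (f : Fin n → PMF β) (v : Fin n) :
    piPMF f = (f v).bind fun y => (piPMF f).bind fun x => PMF.pure (Function.update x v y) := by
  induction n with
  | zero => exact v.elim0
  | succ n ih =>
    refine Fin.cases ?_ (fun i => ?_) v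
    · simp only [piPMF, PMF.bind_bind, PMF.pure_bind, Fin.update_cons_zero, PMF.bind_const]
    · simp only [piPMF, PMF.bind_bind, PMF.pure_bind]
      rw [PMF.bind_comm (f i.succ) (f 0)]
      refine congrArg (PMF.bind (f 0)) (funext fun x => ?_)
      conv_lhs => rw [ih (fun i => f i.succ) i]
      simp only [PMF.bind_bind, PMF.pure_bind, Fin.cons_update]

theorem piPMF_apply {n : ℕ} (f : Fin n → PMF β) (g : Fin n → β) :
    piPMF f g = ∏ i, f i (g i) := by
  classical
  induction n with
  | zero =>
    simp only [piPMF, Finset.univ_eq_empty, Finset.prod_empty]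
    rw [Subsingleton.elim g Fin.elim0, PMF.pure_apply_self]
  | succ n ih =>
    have key : ∀ x (y : Fin n → β), g = Fin.cons x y ↔ x = g 0 ∧ y = Fin.tail g := by
      intro x y
      constructor
      · rintro rfl; simp
      · rintro ⟨rfl, rfl⟩; exact (Fin.cons_self_tail g).symm
    simp only [piPMF, PMF.bind_apply, PMF.pure_apply, key]
    rw [tsum_eq_single (g 0), tsum_eq_single (Fin.tail g), ih, Fin.prod_univ_succ]
    · simp [Fin.tail]
    · intro y hy; simp [hy]
    · intro x hx; simp [hx]

/-- The recursive product also covers infinite types such as lists of outcomes, where `indep` is not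
available. -/
theorem indep_eq_piPMF {n : ℕ} [Fintype β] (f : Fin n → PMF β) : indep f = piPMF f := by
  ext g
  rw [piPMF_apply]
  rfl

end Product

/-! ## Lazy sampling

In the lazy network only the pairs that have been played are recorded, and the outcome of a duel
is drawn when the leader's algorithm uses it. -/

section Lazy

variable {A : Type}

/-- Independent duels of the pairs in a list. -/
def duels (P : PreferenceMatrix A) : List (A × A) → PMF (List ((A × A) × Bool))
  | [] => PMF.pure []
  | e :: l => (P.duel e).bind fun x => (duels P l).bind fun xs => PMF.pure ((e, x) :: xs)

theorem map_fst_of_mem_support_duels (P : PreferenceMatrix A) (l : List (A × A)) :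
    ∀ p ∈ (duels P l).support, p.map Prod.fst = l := by
  induction l with
  | nil => simp [duels]
  | cons e l ih =>
    intro p hp
    simp only [duels, PMF.mem_support_bind_iff, PMF.mem_support_pure_iff] at hp
    obtain ⟨x, -, xs, hxs, rfl⟩ := hp
    simp [ih xs hxs]

theorem length_of_mem_support_duels (P : PreferenceMatrix A) (l : List (A × A))
    {p : List ((A × A) × Bool)} (hp : p ∈ (duels P l).support) : p.length = l.length := by
  rw [← map_fst_of_mem_support_duels P l p hp, List.length_map]

theorem duels_append (P : PreferenceMatrix A) (l l' : List (A × A)) :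
    duels P (l ++ l') = (duels P l).bind fun p => (duels P l').bind fun q => PMF.pure (p ++ q) := by
  induction l with
  | nil => simp [duels]
  | cons e l ih => simp [duels, ih, PMF.bind_bind]

theorem duels_take_drop (P : PreferenceMatrix A) (l : List (A × A)) (k : ℕ) :
    ((duels P l).bind fun p => PMF.pure (p.take k, p.drop k)) =
      (duels P (l.take k)).bind fun p => (duels P (l.drop k)).bind fun q => PMF.pure (p, q) := by
  conv_lhs => rw [← List.take_append_drop k l, duels_append]
  simp only [PMF.bind_bind, PMF.pure_bind]
  refine bind_congr_support _ fun p hp => ?_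
  refine bind_congr_support _ fun q hq => ?_
  have h1 := length_of_mem_support_duels P _ hp
  have h2 := length_of_mem_support_duels P _ hq
  rw [List.length_take] at h1
  rw [List.length_drop] at h2
  rcases le_total k l.length with h | h
  · rw [List.take_left' (by omega), List.drop_left' (by omega)]
  · obtain rfl : q = [] := List.length_eq_zero_iff.1 (by omega)
    rw [List.append_nil, List.take_of_length_le (by omega), List.drop_of_length_le (by omega)]

theorem duels_take (P : PreferenceMatrix A) (l : List (A × A)) (k : ℕ) :
    duels P (l.take k) = (duels P l).bind fun p => PMF.pure (p.take k) := by
  have h := congrArg (PMF.map Prod.fst) (duels_take_drop P l k)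
  simpa [PMF.map_bind, PMF.pure_map, PMF.bind_const, PMF.bind_pure] using h.symm

/-- Independent duels of the concatenation of several lists of pairs. -/
theorem piPMF_duels_flatMap (P : PreferenceMatrix A) {m : ℕ} (L : Fin m → List (A × A)) :
    ((piPMF fun w => duels P (L w)).bind fun b => PMF.pure ((List.finRange m).flatMap b)) =
      duels P ((List.finRange m).flatMap L) := by
  induction m with
  | zero => simp [piPMF, duels]
  | succ m ih =>
    have h := ih fun i => L i.succ
    simp only [List.finRange_succ, List.flatMap_cons, List.flatMap_map, duels_append, ← h, piPMF,
      PMF.bind_bind, PMF.pure_bind, Fin.cons_zero, Fin.cons_succ]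

variable [DecidableEq A]

/-- The queues that are fed by a list of pairs with outcomes. -/
def toQueues (p : List ((A × A) × Bool)) : Queues A :=
  fun e => (p.filter fun x => x.1 = e).map Prod.snd

theorem toQueues_append (p q : List ((A × A) × Bool)) (e : A × A) :
    toQueues (p ++ q) e = toQueues p e ++ toQueues q e := by
  simp [toQueues]

theorem toQueues_eq_nil {p : List ((A × A) × Bool)} {e : A × A} (h : e ∉ p.map Prod.fst) :
    toQueues p e = [] := by
  simp only [toQueues, List.map_eq_nil_iff, List.filter_eq_nil_iff, decide_eq_true_eq]
  rintro x hx rfl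
  exact h (List.mem_map_of_mem hx)

theorem toQueues_cons (x : (A × A) × Bool) (p : List ((A × A) × Bool)) (e : A × A) :
    toQueues (x :: p) e = if x.1 = e then x.2 :: toQueues p e else toQueues p e := by
  by_cases h : x.1 = e <;> simp [toQueues, h]

variable [Fintype A]

/-- The leader's loop with outcomes drawn on demand: the third component is the list of available
pairs, the fourth one collects the pairs whose outcomes have been used. -/
def lazyLoop (P : PreferenceMatrix A) (π : Algorithm A) (st : π.State) (pool used : List (A × A)) :
    PMF ((A × A) × π.State × List (A × A) × List (A × A)) :=
  (π.select st).bind fun s =>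
    if _h : s.1 ∈ pool then
      (P.duel s.1).bind fun x =>
        lazyLoop P π (π.update s.2 s.1 x) (pool.erase s.1) (s.1 :: used)
    else PMF.pure (s.1, s.2, pool, used)
termination_by pool.length
decreasing_by
  rw [List.length_erase_of_mem _h]
  have := List.length_pos_of_mem _h
  omega

/-- Deferred decisions for one loop: a selection does not look at the queues, so it commutes with
drawing them, and the outcomes that the loop leaves behind are still fresh independent duels. -/
theorem duels_bind_leaderLoop (P : PreferenceMatrix A) (π : Algorithm A) :
    ∀ (N : ℕ) (st : π.State) (pool used : List (A × A)), pool.length = N →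
      ((duels P pool).bind fun p => leaderLoop π st (toQueues p)) =
        (lazyLoop P π st pool used).bind fun l => (duels P l.2.2.1).bind fun p =>
          PMF.pure (l.1, l.2.1, toQueues p) := by
  intro N
  induction N with
  | zero =>
    intro st pool used hN
    obtain rfl := List.length_eq_zero_iff.1 hN
    rw [lazyLoop]
    simp only [duels, PMF.pure_bind]
    rw [leaderLoop]
    simp only [List.not_mem_nil, dite_false, PMF.bind_bind, PMF.pure_bind, duels]
    refine congrArg (PMF.bind (π.select st)) (funext fun s => ?_)
    split
    · rfl
    · next h => simp [toQueues] at h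
  | succ N ih =>
    intro st pool used hN
    rw [lazyLoop]
    conv_lhs => enter [2, p]; rw [leaderLoop]
    rw [PMF.bind_comm, PMF.bind_bind]
    refine congrArg (PMF.bind (π.select st)) (funext fun s => ?_)
    split_ifs with hs
    -- The split at the first occurrence of the pair matches first-in-first-out: this occurrence
    -- carries the head of the queue, since `l₁` contributes nothing to it.
    · obtain ⟨l₁, l₂, hl, rfl, he⟩ := List.exists_erase_eq hs
      rw [he, PMF.bind_bind]
      have hlen : (l₁ ++ l₂).length = N := by simp at hN ⊢; omega
      have key : ∀ x, _ := fun x => ih (π.update s.2 s.1 x) (l₁ ++ l₂) (s.1 :: used) hlen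
      simp only [← key, duels_append, duels, PMF.bind_bind, PMF.pure_bind]
      rw [PMF.bind_comm (P.duel s.1)]
      refine bind_congr_support _ fun p hp => ?_
      refine congrArg (PMF.bind (P.duel s.1)) (funext fun x => ?_)
      refine congrArg (PMF.bind (duels P l₂)) (funext fun q => ?_)
      have h0 : toQueues p s.1 = [] :=
        toQueues_eq_nil (by rw [map_fst_of_mem_support_duels P l₁ p hp]; exact hl)
      have h1 : toQueues (p ++ (s.1, x) :: q) s.1 = x :: toQueues q s.1 := by
        rw [toQueues_append, h0, toQueues_cons, if_pos rfl]; rfl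
      have h2 : Function.update (toQueues (p ++ (s.1, x) :: q)) s.1 (toQueues q s.1) =
          toQueues (p ++ q) := by
        funext e
        by_cases h : e = s.1
        · subst h
          rw [Function.update_self, toQueues_append, h0]; rfl
        · rw [Function.update_of_ne h, toQueues_append, toQueues_append, toQueues_cons,
            if_neg (Ne.symm h)]
      split
      · next h => rw [h1] at h; simp at h
      · next y ys h =>
        rw [h1] at h
        obtain ⟨rfl, rfl⟩ := List.cons_eq_cons.1 h
        rw [h2]
    · rw [PMF.pure_bind]
      refine bind_congr_support _ fun p hp => ?_
      have h0 : toQueues p s.1 = [] :=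
        toQueues_eq_nil (by rw [map_fst_of_mem_support_duels P _ p hp]; exact hs)
      split
      · rfl
      · next h => rw [h0] at h; simp at h

end Lazy

/-! ### Equality in law of the network and the lazy network -/

section LazyNetwork

variable {A : Type} [Fintype A] [DecidableEq A] [Nonempty A] {m : ℕ} {π : Algorithm A}

/-- The state of the lazy network: the state of the leader's algorithm, the pairs whose outcomes
are available to the leader, the pairs played in the completed rounds (the most recent round
first), and the pairs whose outcomes have been used by the algorithm. -/
structure LazyNetwork (π : Algorithm A) (m : ℕ) where
  alg : π.State
  pool : List (A × A)
  log : List (Fin m → A × A)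
  used : List (A × A)

/-- The pairs played by `w` whose outcomes are still under way to the leader. -/
def inTransit (G : SimpleGraph (Fin m)) (v : Fin m) (log : List (Fin m → A × A)) (w : Fin m) :
    List (A × A) :=
  (log.map fun r => r w).take (G.dist v w)

/-- The pairs whose outcomes reach the leader at the start of the next round. -/
def arrivals (G : SimpleGraph (Fin m)) (v : Fin m) (log : List (Fin m → A × A)) : List (A × A) :=
  (List.finRange m).flatMap fun w => (inTransit G v log w).drop (G.dist v w - 1)

/-- The pair played by `w` in the next round, when the leader plays `e`. -/
def lazyPlay (G : SimpleGraph (Fin m)) (v : Fin m) (log : List (Fin m → A × A)) (e : A × A)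
    (w : Fin m) : PMF (A × A) :=
  if w = v then PMF.pure e
  else
    match log[G.dist v w - 1]? with
    | some r => PMF.pure (r v)
    | none => PMF.uniformOfFintype (A × A)

/-- One round of the lazy network. -/
def lazyRound (P : PreferenceMatrix A) (G : SimpleGraph (Fin m)) (v : Fin m)
    (s : LazyNetwork π m) : PMF (LazyNetwork π m) :=
  (lazyLoop P π s.alg (s.pool ++ arrivals G v s.log) s.used).bind fun l =>
    (piPMF (lazyPlay G v s.log l.1)).bind fun r =>
      (P.duel l.1).bind fun x =>
        PMF.pure
          { alg := π.update l.2.1 l.1 x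
            pool := l.2.2.1
            log := r :: s.log
            used := l.1 :: l.2.2.2 }

/-- The law of the state of the lazy network after `n` rounds. -/
def lazyQuack (π : Algorithm A) (P : PreferenceMatrix A) (G : SimpleGraph (Fin m)) (v : Fin m) :
    ℕ → PMF (LazyNetwork π m)
  | 0 => PMF.pure { alg := π.init, pool := [], log := [], used := [] }
  | n + 1 => (lazyQuack π P G v n).bind (lazyRound P G v)

/-- The part of the state of the network that matters for its future: the algorithm, the queues,
the outcomes under way to the leader, and the pairs played. -/
abbrev Core (π : Algorithm A) (m : ℕ) : Type :=
  π.State × Queues A × (Fin m → List ((A × A) × Bool)) × List (Fin m → A × A)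

/-- The core of a state of the network. -/
def Network.core (G : SimpleGraph (Fin m)) (v : Fin m) (s : Network π m) : Core π m :=
  (s.alg, s.queues, fun w => (s.log.map fun r => r w).take (G.dist v w),
    s.log.map fun r w => (r w).1)

/-- One round of QuACK in terms of cores. -/
def coreRound (P : PreferenceMatrix A) (G : SimpleGraph (Fin m)) (v : Fin m) (s : Core π m) :
    PMF (Core π m) :=
  (leaderLoop π s.1 fun e => s.2.1 e ++
      toQueues ((List.finRange m).flatMap fun w => (s.2.2.1 w).drop (G.dist v w - 1)) e).bind
    fun l =>
      (piPMF fun w => (lazyPlay G v s.2.2.2 l.1 w).bind fun e =>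
          (P.duel e).bind fun x => PMF.pure (e, x)).bind fun r =>
        PMF.pure (π.update l.2.1 l.1 (r v).2, l.2.2,
          fun w => (r w :: (s.2.2.1 w).take (G.dist v w - 1)).take (G.dist v w),
          (fun w => (r w).1) :: s.2.2.2)

theorem filterMap_eq_flatMap {X Y : Type} (f : X → Option Y) (l : List X) :
    l.filterMap f = l.flatMap fun x => (f x).toList := by
  induction l with
  | nil => rfl
  | cons x l ih =>
    cases h : f x <;> simp [h, ih]

theorem drop_take_eq_toList {X : Type} (l : List X) {d : ℕ} (hd : d ≠ 0) :
    (l.take d).drop (d - 1) = (l[d - 1]?).toList := by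
  obtain ⟨d, rfl⟩ := Nat.exists_eq_succ_of_ne_zero hd
  rw [List.drop_take]
  simp only [Nat.succ_eq_add_one, Nat.add_sub_cancel, Nat.add_sub_cancel_left]
  rw [List.take_one, List.head?_drop]

theorem take_cons_take {X : Type} (x : X) (l : List X) (d : ℕ) :
    (x :: (l.take d).take (d - 1)).take d = (x :: l).take d := by
  cases d with
  | zero => rfl
  | succ d => simp [List.take_take]

/-- Cores evolve autonomously: outcomes older than the delay have already been delivered, and
followers copy pairs without looking at outcomes. Connectedness makes every follower's delay
positive, so that `d - 1` is a genuine index. -/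
theorem quackRound_map_core (P : PreferenceMatrix A) {G : SimpleGraph (Fin m)} (hG : G.Connected)
    (v : Fin m) (s : Network π m) :
    (quackRound P G v s).map (Network.core G v) = coreRound P G v (s.core G v) := by
  have hpos : ∀ w, w ≠ v → G.dist v w ≠ 0 := fun w hw h =>
    hw ((hG.dist_eq_zero_iff).1 h).symm
  have hmsg : s.messages G v = (List.finRange m).flatMap fun w =>
      ((s.core G v).2.2.1 w).drop (G.dist v w - 1) := by
    unfold Network.messages
    rw [filterMap_eq_flatMap]
    refine List.flatMap_congr fun w _ => ?_
    by_cases hw : w = v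
    · subst hw; simp [Network.core]
    · simp only [hw, if_false, Network.core, Network.ago]
      rw [drop_take_eq_toList _ (hpos w hw), List.getElem?_map]
  have hplay : ∀ e w, s.play G v e w = lazyPlay G v (s.core G v).2.2.2 e w := by
    intro e w
    unfold Network.play lazyPlay Network.ago
    simp only [Network.core, List.getElem?_map]
    split_ifs
    · rfl
    · cases s.log[G.dist v w - 1]? <;> rfl
  have hrec : s.received G v = fun e => (s.core G v).2.1 e ++
      toQueues ((List.finRange m).flatMap fun w =>
        ((s.core G v).2.2.1 w).drop (G.dist v w - 1)) e := by
    rw [← hmsg]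
    rfl
  unfold quackRound coreRound
  rw [PMF.map_bind, hrec]
  refine congrArg (PMF.bind _) (funext fun l => ?_)
  rw [PMF.map_bind, indep_eq_piPMF]
  simp only [hplay, PMF.map, Function.comp_def]
  refine congrArg (PMF.bind _) (funext fun r => ?_)
  rw [PMF.pure_bind]
  simp only [Network.core, List.map_cons, take_cons_take]

/-- The law of the core of the network given the state of the lazy network. -/
def fill (P : PreferenceMatrix A) (G : SimpleGraph (Fin m)) (v : Fin m) (s : LazyNetwork π m) :
    PMF (Core π m) :=
  (duels P s.pool).bind fun p => (piPMF fun w => duels P (inTransit G v s.log w)).bind fun q =>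
    PMF.pure (s.alg, toQueues p, q, s.log)

theorem piPMF_lazyPlay_bind {X : Type} (G : SimpleGraph (Fin m)) (v : Fin m)
    (log : List (Fin m → A × A)) (e : A × A) (F : (Fin m → A × A) → PMF X) :
    (piPMF (lazyPlay G v log e)).bind F =
      (piPMF (lazyPlay G v log e)).bind fun r => F (Function.update r v e) := by
  conv_lhs => rw [piPMF_resample _ v]
  simp [lazyPlay, PMF.bind_bind]

theorem piPMF_duels_take_drop (P : PreferenceMatrix A) (H : Fin m → List (A × A)) (k : Fin m → ℕ)
    {X : Type} (F : (Fin m → List ((A × A) × Bool)) → (Fin m → List ((A × A) × Bool)) → PMF X) :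
    ((piPMF fun w => duels P (H w)).bind fun q =>
        F (fun w => (q w).take (k w)) fun w => (q w).drop (k w)) =
      (piPMF fun w => duels P ((H w).take (k w))).bind fun a =>
        (piPMF fun w => duels P ((H w).drop (k w))).bind fun b => F a b := by
  have h : ((piPMF fun w => duels P (H w)).bind fun q =>
      PMF.pure fun w => ((q w).take (k w), (q w).drop (k w))) =
      (piPMF fun w => duels P ((H w).take (k w))).bind fun a =>
        (piPMF fun w => duels P ((H w).drop (k w))).bind fun b =>
          PMF.pure fun w => (a w, b w) := by
    rw [← piPMF_bind_pure (fun w => duels P (H w)) fun w q => (q.take (k w), q.drop (k w))]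
    simp only [duels_take_drop, piPMF_bind, piPMF_pure]
  have h2 := congrArg (fun p => p.bind fun c => F (fun w => (c w).1) fun w => (c w).2) h
  simpa only [PMF.bind_bind, PMF.pure_bind] using h2

/-- The intertwining relation behind the equality in law: filling in all unread outcomes and then
playing a round is the same as playing a lazy round and filling in afterwards. -/
theorem fill_bind_coreRound (P : PreferenceMatrix A) (G : SimpleGraph (Fin m)) (v : Fin m)
    (s : LazyNetwork π m) :
    (fill P G v s).bind (coreRound P G v) = (lazyRound P G v s).bind (fill P G v) := by
  let T := fun w => (inTransit G v s.log w).take (G.dist v w - 1)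
  let F := fun (l : (A × A) × π.State × Queues A) (a : Fin m → List ((A × A) × Bool)) =>
    (piPMF fun w => (lazyPlay G v s.log l.1 w).bind fun e =>
      (P.duel e).bind fun x => PMF.pure (e, x)).bind fun r =>
        PMF.pure ((π.update l.2.1 l.1 (r v).2, l.2.2,
          fun w => (r w :: a w).take (G.dist v w), (fun w => (r w).1) :: s.log) : Core π m)
  -- the loop consumes outcomes that are independent of everything else
  have h1 : (fill P G v s).bind (coreRound P G v) =
      (piPMF fun w => duels P (T w)).bind fun a =>
        (lazyLoop P π s.alg (s.pool ++ arrivals G v s.log) s.used).bind fun l =>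
          (duels P l.2.2.1).bind fun p => F (l.1, l.2.1, toQueues p) a := by
    simp only [fill, coreRound, PMF.bind_bind, PMF.pure_bind]
    rw [PMF.bind_comm]
    refine (piPMF_duels_take_drop P (inTransit G v s.log) (fun w => G.dist v w - 1) fun a b =>
      (duels P s.pool).bind fun p => (leaderLoop π s.alg fun e => toQueues p e ++
        toQueues ((List.finRange m).flatMap b) e).bind fun l => F l a).trans ?_
    refine congrArg (PMF.bind _) (funext fun a => ?_)
    have h := duels_bind_leaderLoop P π _ s.alg (s.pool ++ arrivals G v s.log) s.used rfl
    replace h := congrArg (fun p => p.bind fun l => F l a) h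
    simp only [PMF.bind_bind, PMF.pure_bind] at h
    rw [← h, duels_append, PMF.bind_comm]
    simp only [PMF.bind_bind, PMF.pure_bind, arrivals]
    rw [← piPMF_duels_flatMap]
    refine congrArg (PMF.bind _) (funext fun p => ?_)
    simp only [PMF.bind_bind, PMF.pure_bind]
    refine congrArg (PMF.bind _) (funext fun b => ?_)
    congr 2
    funext e
    rw [toQueues_append]
  have h2 : ∀ (l : (A × A) × π.State × Queues A),
      ((piPMF fun w => duels P (T w)).bind fun a => F l a) =
        (piPMF (lazyPlay G v s.log l.1)).bind fun r => (P.duel l.1).bind fun x =>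
          (piPMF fun w => duels P (inTransit G v (r :: s.log) w)).bind fun q =>
            PMF.pure (π.update l.2.1 l.1 x, l.2.2, q, r :: s.log) := by
    intro l
    simp only [F, piPMF_bind, piPMF_pure, PMF.bind_bind, PMF.pure_bind]
    rw [PMF.bind_comm]
    conv_lhs => rw [piPMF_lazyPlay_bind]
    conv_rhs => rw [piPMF_lazyPlay_bind]
    refine congrArg (PMF.bind _) (funext fun r => ?_)
    set r' := Function.update r v l.1 with hr'
    have hv : r' v = l.1 := by simp [hr']
    have h3 : ∀ w, duels P (inTransit G v (r' :: s.log) w) =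
        (P.duel (r' w)).bind fun x => (duels P (T w)).bind fun a =>
          PMF.pure (((r' w, x) :: a).take (G.dist v w)) := by
      intro w
      have : inTransit G v (r' :: s.log) w = (r' w :: T w).take (G.dist v w) := by
        simp only [inTransit, T, List.map_cons, take_cons_take]
      rw [this, duels_take, duels]
      simp only [PMF.bind_bind, PMF.pure_bind]
    simp only [h3, piPMF_bind, piPMF_pure, PMF.bind_bind, PMF.pure_bind]
    rw [PMF.bind_comm]
    -- The leader's own outcome feeds the update but is never under way, as `G.dist v v = 0`. It can
    -- thus be drawn separately, and the coordinate `v` of the other draw is truncated to nothing.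
    conv_lhs => rw [piPMF_resample _ v]
    simp only [PMF.bind_bind, PMF.pure_bind, Function.update_self, hv]
    refine congrArg (PMF.bind _) (funext fun y => ?_)
    refine congrArg (PMF.bind _) (funext fun x => ?_)
    refine congrArg (PMF.bind _) (funext fun a => ?_)
    congr 4
    funext w
    by_cases hw : w = v
    · subst hw; simp
    · rw [Function.update_of_ne hw]
  rw [h1, PMF.bind_comm, lazyRound, PMF.bind_bind]
  refine congrArg (PMF.bind _) (funext fun l => ?_)
  rw [PMF.bind_comm]
  simp only [h2, PMF.bind_bind, PMF.pure_bind, fill]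
  rw [PMF.bind_comm]
  refine congrArg (PMF.bind _) (funext fun r => ?_)
  rw [PMF.bind_comm]

theorem quack_map_core (P : PreferenceMatrix A) {G : SimpleGraph (Fin m)} (hG : G.Connected)
    (v : Fin m) (n : ℕ) :
    (quack π P G v n).map (Network.core G v) = (lazyQuack π P G v n).bind (fill P G v) := by
  induction n with
  | zero =>
    simp only [quack, lazyQuack, fill, PMF.pure_bind, PMF.pure_map, Network.core, duels,
      inTransit, List.map_nil, List.take_nil, piPMF_pure]
    rfl
  | succ n ih =>
    simp only [quack, lazyQuack, PMF.bind_bind, ← fill_bind_coreRound]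
    rw [PMF.map_bind, ← PMF.bind_bind, ← ih, PMF.bind_map]
    simp only [quackRound_map_core P hG, Function.comp_def]

end LazyNetwork

/-! ### Pathwise comparison of plays with used outcomes -/

section Counting

variable {A : Type} [Fintype A] [DecidableEq A] {m : ℕ} {π : Algorithm A}

theorem lazyLoop_support {P : PreferenceMatrix A} :
    ∀ (N : ℕ) {st : π.State} {pool used : List (A × A)}, pool.length = N →
      ∀ l ∈ (lazyLoop P π st pool used).support,
        (∀ e, l.2.2.2.count e + l.2.2.1.count e = used.count e + pool.count e) ∧
        (∀ e, used.count e ≤ l.2.2.2.count e) ∧ l.1 ∉ l.2.2.1 := by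
  intro N
  induction N with
  | zero =>
    intro st pool used hN l hl
    obtain rfl := List.length_eq_zero_iff.1 hN
    rw [lazyLoop] at hl
    simp only [List.not_mem_nil, dite_false, PMF.mem_support_bind_iff,
      PMF.mem_support_pure_iff] at hl
    obtain ⟨s, -, rfl⟩ := hl
    simp
  | succ N ih =>
    intro st pool used hN l hl
    rw [lazyLoop, PMF.mem_support_bind_iff] at hl
    obtain ⟨s, -, hl⟩ := hl
    split_ifs at hl with hs
    · rw [PMF.mem_support_bind_iff] at hl
      obtain ⟨x, -, hl⟩ := hl
      have hlen : (pool.erase s.1).length = N := by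
        rw [List.length_erase_of_mem hs]; omega
      obtain ⟨h1, h2, h3⟩ := ih hlen l hl
      refine ⟨fun e => ?_, fun e => ?_, h3⟩
      · rw [h1 e, List.count_cons, List.count_erase]
        have : 0 < pool.count s.1 := List.count_pos_iff.2 hs
        by_cases h : s.1 = e
        · subst h; simp; omega
        · simp [h]
      · refine le_trans ?_ (h2 e)
        rw [List.count_cons]; omega
    · rw [PMF.mem_support_pure_iff] at hl
      subst hl
      exact ⟨fun _ => rfl, fun _ => le_rfl, hs⟩

/-- Lets a statistic of the algorithm's state stand in for the number of used outcomes. An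
inequality is enough, since the statistic may also count other duels, such as those of the swapped
pair. -/
theorem lazyLoop_support_counter {P : PreferenceMatrix A} {e : A × A} {φ : π.State → ℕ}
    (hφ : ∀ st, ∀ s ∈ (π.select st).support, ∀ x,
      φ st + (if s.1 = e then 1 else 0) ≤ φ (π.update s.2 s.1 x)) :
    ∀ (N : ℕ) {st : π.State} {pool used : List (A × A)}, pool.length = N →
      used.count e ≤ φ st → ∀ l ∈ (lazyLoop P π st pool used).support, ∀ x,
        (l.1 :: l.2.2.2).count e ≤ φ (π.update l.2.1 l.1 x) := by
  have step : ∀ {st : π.State} {used : List (A × A)}, used.count e ≤ φ st →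
      ∀ s ∈ (π.select st).support, ∀ x, (s.1 :: used).count e ≤ φ (π.update s.2 s.1 x) := by
    intro st used hu s hs x
    refine le_trans ?_ (hφ st s hs x)
    rw [List.count_cons]
    simp only [beq_iff_eq]
    omega
  intro N
  induction N with
  | zero =>
    intro st pool used hN hu l hl
    obtain rfl := List.length_eq_zero_iff.1 hN
    rw [lazyLoop] at hl
    simp only [List.not_mem_nil, dite_false, PMF.mem_support_bind_iff,
      PMF.mem_support_pure_iff] at hl
    obtain ⟨s, hs, rfl⟩ := hl
    exact step hu s hs
  | succ N ih =>
    intro st pool used hN hu l hl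
    rw [lazyLoop, PMF.mem_support_bind_iff] at hl
    obtain ⟨s, hs, hl⟩ := hl
    split_ifs at hl with hm
    · rw [PMF.mem_support_bind_iff] at hl
      obtain ⟨x, -, hl⟩ := hl
      have hlen : (pool.erase s.1).length = N := by
        rw [List.length_erase_of_mem hm]; omega
      exact ih hlen (step hu s hs x) l hl
    · rw [PMF.mem_support_pure_iff] at hl
      subst hl
      exact step hu s hs

variable [Nonempty A]

/-- What is true of every reachable state of the lazy network: the followers copy the leader with
delay, every outcome that has reached the leader has been used or is available, and the
leader does not get ahead of the outcomes. -/
structure LazyNetwork.Valid (G : SimpleGraph (Fin m)) (v : Fin m) (s : LazyNetwork π m) : Prop where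
  copy : ∀ w, (s.log.map fun r => r v).drop (G.dist v w) <+: s.log.map fun r => r w
  conserve : ∀ e, ∑ w, ((s.log.map fun r => r w).drop (G.dist v w)).count e =
    s.used.count e + s.pool.count e
  lead : ∀ e, m * (s.log.map fun r => r v).count e ≤ s.used.count e + 2 * ∑ w, G.dist v w

theorem count_le_count_drop_add {X : Type} [BEq X] (l : List X) (d : ℕ) (x : X) :
    l.count x ≤ (l.drop d).count x + d := by
  conv_lhs => rw [← List.take_append_drop d l, List.count_append]
  have := (List.count_le_length (a := x) (l := l.take d)).trans (List.length_take_le d l)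
  omega

theorem arrivals_count (G : SimpleGraph (Fin m)) (v : Fin m) (log : List (Fin m → A × A))
    (e : A × A) : (arrivals G v log).count e =
      ∑ w, ((inTransit G v log w).drop (G.dist v w - 1)).count e := by
  rw [arrivals, List.count_flatMap, Fin.sum_univ_def]
  rfl

theorem mem_support_piPMF {β : Type} {n : ℕ} {f : Fin n → PMF β} {x : Fin n → β}
    (hx : x ∈ (piPMF f).support) (i : Fin n) : x i ∈ (f i).support := by
  rw [PMF.mem_support_iff, piPMF_apply] at hx
  rw [PMF.mem_support_iff]
  exact (Finset.prod_ne_zero_iff.1 hx) i (Finset.mem_univ i)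

/-- The point is `lead`. When the leader plays `e`, no outcome of `e` is left in the pool, so all
delivered ones have been used; each agent's delivered plays lag behind the leader's by at most one
delay for copying and one for reporting. In a round with another pair, the left side is unchanged
and the right side cannot decrease. -/
theorem LazyNetwork.Valid.step {P : PreferenceMatrix A} {G : SimpleGraph (Fin m)}
    (hG : G.Connected) {v : Fin m} {s : LazyNetwork π m} (hs : s.Valid G v) :
    ∀ s' ∈ (lazyRound P G v s).support, s'.Valid G v := by
  intro s' h
  simp only [lazyRound, PMF.mem_support_bind_iff, PMF.mem_support_pure_iff] at h
  obtain ⟨l, hl, r, hr, x, -, rfl⟩ := h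
  obtain ⟨hl1, hl2, hl3⟩ := lazyLoop_support _ rfl l hl
  have hrv : r v = l.1 := by
    have := mem_support_piPMF hr v
    simpa [lazyPlay] using this
  have hpos : ∀ w, w ≠ v → G.dist v w ≠ 0 := fun w hw h =>
    hw ((hG.dist_eq_zero_iff).1 h).symm
  have copy : ∀ w, ((r :: s.log).map fun r => r v).drop (G.dist v w) <+:
      (r :: s.log).map fun r => r w := by
    intro w
    by_cases hw : w = v
    · subst hw; simp
    · obtain ⟨d, hd⟩ := Nat.exists_eq_succ_of_ne_zero (hpos w hw)
      have hp := mem_support_piPMF hr w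
      have hc := hs.copy w
      simp only [lazyPlay, hw, if_false, hd, Nat.succ_eq_add_one, Nat.add_sub_cancel] at hp
      rw [hd] at hc ⊢
      simp only [List.map_cons, Nat.succ_eq_add_one, List.drop_succ_cons]
      by_cases hlt : d < s.log.length
      · rw [List.getElem?_eq_getElem hlt] at hp
        rw [PMF.mem_support_pure_iff] at hp
        rw [List.drop_eq_getElem_cons (by simpa using hlt), List.getElem_map, hp]
        exact List.cons_prefix_cons.2 ⟨rfl, hc⟩
      · rw [List.drop_of_length_le (by simpa using hlt)]
        exact List.nil_prefix
  have conserve : ∀ e, ∑ w, (((r :: s.log).map fun r => r w).drop (G.dist v w)).count e =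
      (l.1 :: l.2.2.2).count e + l.2.2.1.count e := by
    intro e
    have key : ∀ w, (((r :: s.log).map fun r => r w).drop (G.dist v w)).count e =
        ((s.log.map fun r => r w).drop (G.dist v w)).count e +
          ((inTransit G v s.log w).drop (G.dist v w - 1)).count e +
          if w = v then (if l.1 = e then 1 else 0) else 0 := by
      intro w
      by_cases hw : w = v
      · subst hw
        simp [inTransit, List.count_cons, hrv]
      · obtain ⟨d, hd⟩ := Nat.exists_eq_succ_of_ne_zero (hpos w hw)
        simp only [hw, if_false, add_zero, inTransit, hd, List.map_cons, Nat.succ_eq_add_one,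
          List.drop_succ_cons, Nat.add_sub_cancel]
        -- With the most recent play first, adding a round moves exactly the play at index `d` from
        -- in transit to delivered.
        rw [← List.count_append, List.perm_append_comm.count_eq, List.drop_take,
          Nat.add_sub_cancel_left, ← List.drop_drop, List.take_append_drop]
    simp only [key, Finset.sum_add_distrib, ← arrivals_count, hs.conserve e, Finset.sum_ite_eq',
      Finset.mem_univ, if_true]
    have := hl1 e
    rw [List.count_append] at this
    rw [List.count_cons]
    simp only [beq_iff_eq]
    omega
  refine ⟨copy, conserve, fun e => ?_⟩
  by_cases he : l.1 = e
  · have h0 : l.2.2.1.count e = 0 := List.count_eq_zero.2 (he ▸ hl3)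
    have hc := conserve e
    rw [h0, add_zero] at hc
    simp only [← hc]
    rw [Finset.mul_sum, ← Finset.sum_add_distrib]
    calc m * (List.map (fun r => r v) (r :: s.log)).count e
        = ∑ w : Fin m, (List.map (fun r => r v) (r :: s.log)).count e := by simp
      _ ≤ _ := Finset.sum_le_sum fun w _ => ?_
    have h1 := count_le_count_drop_add ((r :: s.log).map fun r => r v) (G.dist v w) e
    have h2 := (copy w).sublist.count_le e
    have h3 := count_le_count_drop_add ((r :: s.log).map fun r => r w) (G.dist v w) e
    omega
  · have h1 := hs.lead e
    have h2 := hl2 e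
    simp only [List.map_cons, List.count_cons, hrv, beq_iff_eq, he, if_false, add_zero]
    omega

theorem valid_of_mem_support_lazyQuack {P : PreferenceMatrix A} {G : SimpleGraph (Fin m)}
    (hG : G.Connected) {v : Fin m} (n : ℕ) :
    ∀ s ∈ (lazyQuack π P G v n).support, s.Valid G v := by
  induction n with
  | zero =>
    intro s hs
    simp only [lazyQuack, PMF.mem_support_pure_iff] at hs
    subst hs
    exact ⟨by simp, by simp, by simp⟩
  | succ n ih =>
    intro s hs
    rw [lazyQuack, PMF.mem_support_bind_iff] at hs
    obtain ⟨s₀, h₀, h⟩ := hs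
    exact (ih s₀ h₀).step hG s h

theorem used_count_le {P : PreferenceMatrix A} {G : SimpleGraph (Fin m)} {v : Fin m}
    {e : A × A} {φ : π.State → ℕ}
    (hφ : ∀ st, ∀ s ∈ (π.select st).support, ∀ x,
      φ st + (if s.1 = e then 1 else 0) ≤ φ (π.update s.2 s.1 x)) (n : ℕ) :
    ∀ s ∈ (lazyQuack π P G v n).support, s.used.count e ≤ φ s.alg := by
  induction n with
  | zero =>
    intro s hs
    simp only [lazyQuack, PMF.mem_support_pure_iff] at hs
    subst hs
    simp
  | succ n ih =>
    intro s hs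
    simp only [lazyQuack, PMF.mem_support_bind_iff, lazyRound, PMF.mem_support_pure_iff] at hs
    obtain ⟨s₀, h₀, l, hl, r, -, x, -, rfl⟩ := hs
    exact lazyLoop_support_counter hφ _ rfl (ih s₀ h₀) l hl x

/-- Two of the three delays come from `lead`; the third pays for the random plays of a follower
before the first pair of the leader reaches it. -/
theorem LazyNetwork.Valid.sum_count_le {G : SimpleGraph (Fin m)} {v : Fin m} {s : LazyNetwork π m}
    (hs : s.Valid G v) (e : A × A) :
    ∑ w, (s.log.map fun r => r w).count e ≤ s.used.count e + 3 * ∑ w, G.dist v w := by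
  have h : ∀ w, (s.log.map fun r => r w).count e ≤
      (s.log.map fun r => r v).count e + G.dist v w := by
    intro w
    obtain ⟨t, ht⟩ := hs.copy w
    have h1 : t.length ≤ G.dist v w := by
      have := congrArg List.length ht
      simp at this
      omega
    rw [← ht, List.count_append]
    have h2 := List.count_le_length (a := e) (l := t)
    have h3 := (List.drop_sublist (G.dist v w) (s.log.map fun r => r v)).count_le e
    omega
  have h1 := Finset.sum_le_sum fun w (_ : w ∈ Finset.univ) => h w
  rw [Finset.sum_add_distrib] at h1
  simp only [Finset.sum_const, Finset.card_univ, Fintype.card_fin, smul_eq_mul] at h1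
  have h2 := hs.lead e
  omega

end Counting

/-! ### Comparison with a single run of the algorithm -/

section Value

variable {A : Type} {m : ℕ} {π : Algorithm A}

/-- One step of the single-agent algorithm `π`. -/
def algStep (P : PreferenceMatrix A) (π : Algorithm A) (st : π.State) : PMF π.State :=
  (π.select st).bind fun s => (P.duel s.1).bind fun x => PMF.pure (π.update s.2 s.1 x)

/-- The law of the state of the single-agent algorithm `π` after `n` steps. -/
def algRun (P : PreferenceMatrix A) (π : Algorithm A) : ℕ → PMF π.State
  | 0 => PMF.pure π.init
  | n + 1 => (algRun P π n).bind (algStep P π)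

/-- The expectation of `f` after `n` more steps of the single-agent algorithm. -/
def value (P : PreferenceMatrix A) (f : π.State → ℝ≥0∞) : ℕ → π.State → ℝ≥0∞
  | 0 => f
  | n + 1 => fun st => ev (algStep P π st) (value P f n)

theorem ev_algRun_value (P : PreferenceMatrix A) (f : π.State → ℝ≥0∞) (n r : ℕ) :
    ev (algRun P π n) (value P f r) = ev (algRun P π (n + r)) f := by
  induction r generalizing n with
  | zero => rfl
  | succ r ih =>
    rw [show n + (r + 1) = n + 1 + r by ring, ← ih (n + 1), algRun, ev_bind]
    rfl

theorem value_mono {P : PreferenceMatrix A} {f : π.State → ℝ≥0∞}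
    (hf : ∀ st, f st ≤ ev (algStep P π st) f) {r r' : ℕ} (h : r ≤ r') (st : π.State) :
    value P f r st ≤ value P f r' st := by
  have : Monotone fun r => value P f r := by
    refine monotone_nat_of_le_succ fun r => ?_
    induction r with
    | zero => exact hf
    | succ r ih => exact fun st => ev_mono _ ih
  exact this h st

variable [Fintype A] [DecidableEq A]

/-- The loop stops at a random time, but outcomes read plus outcomes left is constant. Keeping the
leftover as remaining horizon makes the total horizon deterministic; the `+ 1` is the leader's own
duel. -/
theorem ev_lazyLoop_value (P : PreferenceMatrix A) (f : π.State → ℝ≥0∞) (r : ℕ) :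
    ∀ (N : ℕ) (st : π.State) (pool used : List (A × A)), pool.length = N →
      ev (lazyLoop P π st pool used) (fun l => ev (P.duel l.1) fun x =>
        value P f (r + l.2.2.1.length) (π.update l.2.1 l.1 x)) = value P f (r + N + 1) st := by
  have step : ∀ N st, value P f (N + 1) st =
      ev (π.select st) fun s => ev (P.duel s.1) fun x => value P f N (π.update s.2 s.1 x) := by
    intro N st
    simp only [value, algStep, ev_bind, ev_pure]
  intro N
  induction N with
  | zero =>
    intro st pool used hN
    obtain rfl := List.length_eq_zero_iff.1 hN
    rw [lazyLoop, step]
    simp [ev_bind, ev_pure]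
  | succ N ih =>
    intro st pool used hN
    rw [lazyLoop, step, ev_bind]
    congr 1; funext s
    split_ifs with hs
    · rw [ev_bind]
      congr 1; funext x
      exact ih _ _ _ (by rw [List.length_erase_of_mem hs]; omega)
    · rw [ev_pure, hN]

variable [Nonempty A]

theorem arrivals_length_lt (G : SimpleGraph (Fin m)) (v : Fin m) (log : List (Fin m → A × A)) :
    (arrivals G v log).length < m := by
  rw [arrivals, List.length_flatMap, ← Fin.sum_univ_def]
  calc _ < ∑ w : Fin m, 1 := Finset.sum_lt_sum (fun w _ => ?_) ⟨v, Finset.mem_univ _, ?_⟩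
    _ = m := by simp
  · simp only [inTransit, List.length_drop, List.length_take]; omega
  · simp [inTransit]

theorem ev_lazyQuack_le {P : PreferenceMatrix A} (G : SimpleGraph (Fin m)) (v : Fin m)
    {f : π.State → ℝ≥0∞} (hf : ∀ st, f st ≤ ev (algStep P π st) f) (n : ℕ) :
    ev (lazyQuack π P G v n) (fun s => f s.alg) ≤ ev (algRun P π (m * n)) f := by
  -- The potential grants the algorithm all outcomes still in the pool. A round then lengthens the
  -- horizon by at most `m`, whatever the leader selects.
  have h : ∀ r, ev (lazyQuack π P G v n) (fun s => value P f (r + s.pool.length) s.alg) ≤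
      value P f (r + m * n) π.init := by
    induction n with
    | zero => intro r; simp [lazyQuack, ev_pure]
    | succ n ih =>
      intro r
      rw [lazyQuack, ev_bind]
      calc _ ≤ ev (lazyQuack π P G v n)
              (fun s => value P f (r + m + s.pool.length) s.alg) := ev_mono _ fun s => ?_
        _ ≤ _ := (ih (r + m)).trans (by rw [Nat.mul_succ, add_assoc, add_comm m])
      simp only [lazyRound, ev_bind, ev_pure, ev_const]
      rw [ev_lazyLoop_value P f r _ _ _ _ rfl]
      refine value_mono hf ?_ _
      have := arrivals_length_lt G v s.log
      rw [List.length_append]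
      omega
  calc _ ≤ ev (lazyQuack π P G v n) (fun s => value P f (0 + s.pool.length) s.alg) :=
        ev_mono _ fun s => value_mono hf (Nat.zero_le _) _
    _ ≤ _ := h 0
    _ = _ := by
      have := ev_algRun_value P f 0 (m * n)
      rw [algRun, ev_pure] at this
      rw [Nat.zero_add, this, Nat.zero_add]

/-- The expected number of plays of a pair in the whole network is bounded by the expected number
of plays of this pair in a single run of the algorithm, up to the delays. -/
theorem ev_plays_le {P : PreferenceMatrix A} {G : SimpleGraph (Fin m)} (hG : G.Connected)
    (v : Fin m) {e : A × A} {φ : π.State → ℕ}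
    (hφ : ∀ st, ∀ s ∈ (π.select st).support, ∀ x,
      φ st + (if s.1 = e then 1 else 0) ≤ φ (π.update s.2 s.1 x)) (n : ℕ) :
    ev (quack π P G v n) (fun s => ((∑ w, s.plays e w : ℕ) : ℝ≥0∞)) ≤
      ev (algRun P π (m * n)) (fun st => (φ st : ℝ≥0∞)) +
        ((3 * ∑ w, G.dist v w : ℕ) : ℝ≥0∞) := by
  let F : Core π m → ℝ≥0∞ := fun c => ((∑ w, (c.2.2.2.map fun r => r w).count e : ℕ) : ℝ≥0∞)
  have h1 : ∀ s : Network π m, ((∑ w, s.plays e w : ℕ) : ℝ≥0∞) = F (s.core G v) := by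
    intro s
    simp only [F, Network.core, Network.plays, List.count, List.countP_map, Function.comp_def]
    congr 2; funext w; congr 1; funext r
    rw [Bool.eq_iff_iff]; simp
  simp only [h1]
  rw [← ev_map, quack_map_core P hG, ev_bind]
  have h2 : ∀ s : LazyNetwork π m, ev (fill P G v s) F =
      ((∑ w, (s.log.map fun r => r w).count e : ℕ) : ℝ≥0∞) := by
    intro s
    simp only [fill, ev_bind, ev_pure, F, ev_const]
  simp only [h2]
  calc _ ≤ ev (lazyQuack π P G v n)
          (fun s => (φ s.alg : ℝ≥0∞) + ((3 * ∑ w, G.dist v w : ℕ) : ℝ≥0∞)) :=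
        ev_mono_support _ fun s hs => ?_
    _ ≤ _ := ?_
  · rw [← Nat.cast_add, Nat.cast_le]
    exact ((valid_of_mem_support_lazyQuack hG n s hs).sum_count_le e).trans
      (Nat.add_le_add_right (used_count_le hφ n s hs) _)
  · rw [ev_add, ev_const]
    gcongr
    refine ev_lazyQuack_le G v (f := fun st => (φ st : ℝ≥0∞)) (fun st => ?_) n
    simp only [algStep, ev_bind, ev_pure]
    rw [← ev_const (π.select st) (φ st : ℝ≥0∞)]
    refine ev_mono_support _ fun s hs => ?_
    rw [← ev_const (P.duel s.1) (φ st : ℝ≥0∞)]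
    refine ev_mono _ fun x => ?_
    exact Nat.cast_le.2 ((Nat.le_add_right _ _).trans (hφ st s hs x))

end Value

/-! ## Analysis of RUCB -/

namespace RUCB

variable {A : Type} [Fintype A] [DecidableEq A] [Nonempty A]

theorem mem_of_mem_support_uniformOrAll {s : Finset A} (hs : s.Nonempty) {x : A}
    (hx : x ∈ (uniformOrAll s).support) : x ∈ s := by
  rw [uniformOrAll, dif_pos hs] at hx
  exact (PMF.mem_support_uniformOfFinset_iff hs x).1 hx

/-- With at least two candidates the best arm survives only if it lies in `C`. This is all that the
analysis needs to know about the best arm and the coin. -/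
theorem mem_of_mem_support_champion {C : Finset A} (hC : C.Nonempty) (best : Option A) {c : A}
    (hc : c ∈ (champion C (newBest best C)).support) : c ∈ C := by
  unfold champion at hc
  split_ifs at hc with h1
  · exact mem_of_mem_support_uniformOrAll hC hc
  · have h2 : C.card ≠ 1 := by omega
    rw [newBest, dif_neg h2] at hc
    split at hc
    · exact mem_of_mem_support_uniformOrAll hC hc
    · next b hb =>
      rw [Option.filter_eq_some_iff] at hb
      rw [PMF.mem_support_bind_iff] at hc
      obtain ⟨coin, -, hc⟩ := hc
      split_ifs at hc
      · rw [PMF.mem_support_pure_iff] at hc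
        rw [hc]
        simpa using hb.2
      · refine Finset.mem_of_mem_erase (mem_of_mem_support_uniformOrAll ?_ hc)
        rw [← Finset.card_pos]
        have := Finset.pred_card_le_card_erase (s := C) (a := b)
        omega

theorem le_of_mem_support_challenger {α : ℝ} {M : Memory A} {c d : A}
    (hd : d ∈ (challenger α M c).support) (j : A) : ucb α M j c ≤ ucb α M d c := by
  have hne : (maximisers α M c).Nonempty := by
    obtain ⟨d, -, hd⟩ := Finset.exists_max_image Finset.univ (fun j => ucb α M j c)
      Finset.univ_nonempty
    exact ⟨d, by simpa [maximisers] using hd⟩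
  have hmem : d ∈ maximisers α M c := by
    unfold challenger at hd
    split_ifs at hd with h
    · exact mem_of_mem_support_uniformOrAll hne hd
    · refine Finset.mem_of_mem_erase (mem_of_mem_support_uniformOrAll ?_ hd)
      rw [← Finset.card_pos]
      have := Finset.pred_card_le_card_erase (s := maximisers α M c) (a := c)
      omega
  simp only [maximisers, Finset.mem_filter] at hmem
  exact hmem.2 j

/-- The law of the pair selected by RUCB and of its memory after the selection. -/
def select (α : ℝ) (M : Memory A) : PMF ((A × A) × Memory A) := (rucb A α).select M

/-- The memory after the outcome `x` of the duel of the pair `e`. -/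
def next (α : ℝ) (M : Memory A) (e : A × A) (x : Bool) : Memory A := (rucb A α).update M e x

/-- One step of RUCB. -/
def step (P : PreferenceMatrix A) (α : ℝ) (M : Memory A) : PMF (Memory A) :=
  algStep P (rucb A α) M

/-- The law of the memory after `n` steps of RUCB. -/
def run (P : PreferenceMatrix A) (α : ℝ) (n : ℕ) : PMF (Memory A) := algRun P (rucb A α) n

theorem step_eq (P : PreferenceMatrix A) (α : ℝ) (M : Memory A) :
    step P α M = (select α M).bind fun s => (P.duel s.1).bind fun x =>
      PMF.pure (next α s.2 s.1 x) := rfl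

theorem run_zero (P : PreferenceMatrix A) (α : ℝ) :
    run P α 0 = PMF.pure { wins := fun _ _ => 0, best := none, rounds := 0 } := rfl

theorem run_succ (P : PreferenceMatrix A) (α : ℝ) (n : ℕ) :
    run P α (n + 1) = (run P α n).bind (step P α) := rfl

theorem select_eq (α : ℝ) (M : Memory A) :
    select α M = (champion (candidates α M) (newBest M.best (candidates α M))).bind fun c =>
      (challenger α M c).bind fun d =>
        PMF.pure ((c, d), { M with best := newBest M.best (candidates α M) }) := rfl

/-- The number of duels between `i` and `j`. -/
def duelCount (M : Memory A) (i j : A) : ℕ := M.wins i j + M.wins j i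

theorem ucb_add_ucb (α : ℝ) (M : Memory A) {i j : A} (hij : i ≠ j) (h : duelCount M i j ≠ 0) :
    ucb α M i j + ucb α M j i =
      1 + 2 * √(α * Real.log (M.rounds + 1) / duelCount M i j) := by
  have h1 : (M.wins i j : ℝ) + M.wins j i ≠ 0 := by
    have : ((duelCount M i j : ℕ) : ℝ) ≠ 0 := Nat.cast_ne_zero.2 h
    simpa [duelCount] using this
  have h2 : (M.wins j i : ℝ) + M.wins i j ≠ 0 := by rwa [add_comm]
  simp only [ucb, hij, hij.symm, if_false, divOne, h1, h2, duelCount, Nat.cast_add]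
  rw [add_comm (M.wins j i : ℝ) (M.wins i j : ℝ)]
  field_simp
  ring

/-- If the optimistic estimates of `i` against `j` and of `j` against `i` are too large, then
there have been few duels between them. -/
theorem duelCount_le {α : ℝ} (hα : 0 ≤ α) {M : Memory A} {i j : A} (hij : i ≠ j) {Δ : ℝ}
    (hΔ : 0 < Δ) (h : 1 + Δ ≤ ucb α M i j + ucb α M j i) :
    (duelCount M i j : ℝ) ≤ 4 * α * Real.log (M.rounds + 1) / Δ ^ 2 := by
  have hL : 0 ≤ Real.log (M.rounds + 1) := Real.log_nonneg (by simp)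
  by_cases h0 : duelCount M i j = 0
  · rw [h0, Nat.cast_zero]; positivity
  · rw [ucb_add_ucb α M hij h0] at h
    have hN : (0 : ℝ) < duelCount M i j := Nat.cast_pos.2 (Nat.pos_of_ne_zero h0)
    have h1 : Δ / 2 ≤ √(α * Real.log (M.rounds + 1) / duelCount M i j) := by linarith
    rw [Real.le_sqrt (by positivity) (by positivity), le_div_iff₀ hN] at h1
    rw [le_div_iff₀ (by positivity)]
    linarith

/-- The optimistic estimates of `a` are too small. -/
def Bad (P : PreferenceMatrix A) (α : ℝ) (a j : A) (M : Memory A) : Prop :=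
  ucb α M a j < P.prob a j

/-- As long as the estimates of the Condorcet winner are optimistic, only pairs that have been
compared few times are selected. -/
theorem duelCount_le_of_mem_support_select {P : PreferenceMatrix A} {α : ℝ} (hα : 0 ≤ α) {a : A}
    {Δ : ℝ} (hΔ : 0 < Δ) (hgap : ∀ b, b ≠ a → Δ ≤ P.gap a b) {M : Memory A}
    (hM : ∀ j, j ≠ a → ¬ Bad P α a j M) {s : (A × A) × Memory A}
    (hs : s ∈ (select α M).support) (hne : s.1 ≠ (a, a)) :
    (duelCount M s.1.1 s.1.2 : ℝ) ≤ 4 * α * Real.log (M.rounds + 1) / Δ ^ 2 := by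
  have hopt : ∀ j, j ≠ a → 1 / 2 + Δ ≤ ucb α M a j := by
    intro j hj
    have h1 := not_lt.1 (hM j hj)
    have h2 := hgap j hj
    unfold PreferenceMatrix.gap at h2
    linarith
  have haC : a ∈ candidates α M := by
    simp only [candidates, Finset.mem_filter, Finset.mem_univ, true_and]
    intro j
    by_cases hj : j = a
    · rw [hj, ucb, if_pos rfl]
    · linarith [hopt j hj]
  simp only [select_eq, PMF.mem_support_bind_iff, PMF.mem_support_pure_iff] at hs
  obtain ⟨c, hc, d, hd, rfl⟩ := hs
  have hcC := mem_of_mem_support_champion ⟨a, haC⟩ _ hc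
  simp only [candidates, Finset.mem_filter, Finset.mem_univ, true_and] at hcC
  have hdmax := le_of_mem_support_challenger hd
  simp only at hne ⊢
  -- If `c = a`, the challenger beats `u a a = 1/2` while `u a d ≥ 1/2 + Δ`. If `c ≠ a`, then `u d c
  -- ≥ u a c ≥ 1/2 + Δ` excludes `d = c`, and `u c d ≥ 1/2` because `c` is a candidate.
  by_cases hca : c = a
  · subst hca
    have hdc : d ≠ c := fun h => hne (by rw [h])
    have h1 := hdmax c
    rw [ucb, if_pos rfl] at h1
    exact duelCount_le hα hdc.symm hΔ (by linarith [hopt d hdc])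
  · have h1 := hdmax a
    have h2 := hopt c hca
    by_cases hdc : d = c
    · subst hdc
      rw [ucb.eq_def α M d d, if_pos rfl] at h1
      linarith
    · exact duelCount_le hα (Ne.symm hdc) hΔ (by linarith [hcC d])

theorem wins_rounds_of_mem_support_select {α : ℝ} {M : Memory A}
    {s : (A × A) × Memory A} (hs : s ∈ (select α M).support) :
    s.2.wins = M.wins ∧ s.2.rounds = M.rounds := by
  simp only [select_eq, PMF.mem_support_bind_iff, PMF.mem_support_pure_iff] at hs
  obtain ⟨c, -, d, -, rfl⟩ := hs
  exact ⟨rfl, rfl⟩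

theorem duelCount_update {α : ℝ} (M : Memory A) (e : A × A) (x : Bool) (i j : A) :
    duelCount (next α M e x) i j = duelCount M i j +
      ((if e = (i, j) then 1 else 0) + if e = (j, i) then 1 else 0) := by
  obtain ⟨c, d⟩ := e
  cases x
  · simp only [next, rucb, duelCount, Bool.false_eq_true, if_false, Prod.mk.injEq, eq_comm (a := c),
      eq_comm (a := d), and_comm]
    omega
  · simp only [next, rucb, duelCount, if_true, Prod.mk.injEq, eq_comm (a := c), eq_comm (a := d)]
    omega

theorem duelCount_select_update {α : ℝ} {M : Memory A} {s : (A × A) × Memory A}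
    (hs : s ∈ (select α M).support) (x : Bool) (i j : A) :
    duelCount (next α s.2 s.1 x) i j = duelCount M i j +
      ((if s.1 = (i, j) then 1 else 0) + if s.1 = (j, i) then 1 else 0) := by
  rw [duelCount_update, duelCount, (wins_rounds_of_mem_support_select hs).1, ← duelCount]

theorem mem_support_step {P : PreferenceMatrix A} {α : ℝ} {M M' : Memory A}
    (h : M' ∈ (step P α M).support) :
    ∃ s ∈ (select α M).support, ∃ x, M' = next α s.2 s.1 x := by
  simp only [step_eq, PMF.mem_support_bind_iff, PMF.mem_support_pure_iff] at h
  obtain ⟨s, hs, x, -, rfl⟩ := h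
  exact ⟨s, hs, x, rfl⟩

theorem run_invariant {P : PreferenceMatrix A} {α : ℝ} (n : ℕ) :
    ∀ M ∈ (run P α n).support,
      M.rounds = n ∧ ∀ i j, i ≠ j → duelCount M i j ≤ n := by
  induction n with
  | zero =>
    intro M hM
    rw [run_zero, PMF.mem_support_pure_iff] at hM
    subst hM
    exact ⟨rfl, fun _ _ _ => le_rfl⟩
  | succ n ih =>
    intro M' hM'
    rw [run_succ, PMF.mem_support_bind_iff] at hM'
    obtain ⟨M, hM, h⟩ := hM'
    obtain ⟨s, hs, x, rfl⟩ := mem_support_step h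
    obtain ⟨h1, h2⟩ := ih M hM
    refine ⟨?_, fun i j hij => ?_⟩
    · change s.2.rounds + 1 = n + 1
      rw [(wins_rounds_of_mem_support_select hs).2, h1]
    · rw [duelCount_select_update hs]
      have h3 := h2 i j hij
      have h4 : ¬ (s.1 = (i, j) ∧ s.1 = (j, i)) := by
        rintro ⟨h4, h5⟩
        rw [h4, Prod.mk.injEq] at h5
        exact hij h5.1
      split_ifs with h5 h6
      · exact absurd ⟨h5, h6⟩ h4
      all_goals omega

open Classical in
/-- The expected number of duels of a suboptimal pair is logarithmic, up to twice the expected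
number of steps in which an estimate of the Condorcet winner is too small. -/
theorem ev_duelCount_le {P : PreferenceMatrix A} {α : ℝ} (hα : 0 ≤ α) {a : A}
    {Δ : ℝ} (hΔ : 0 < Δ) (hgap : ∀ b, b ≠ a → Δ ≤ P.gap a b) {i j : A} (hij : (i, j) ≠ (a, a))
    (N : ℕ) :
    ev (run P α N) (fun M => (duelCount M i j : ℝ≥0∞)) ≤
      ENNReal.ofReal (4 * α * Real.log N / Δ ^ 2) + 2 +
        2 * ∑ b ∈ Finset.univ.erase a, ∑ t ∈ Finset.range N,
          ev (run P α t) fun M => if Bad P α a b M then 1 else 0 := by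
  -- The maximum of the count and `K` cannot grow in a step without failure and grows by at most `2`
  -- in any other. The `2` is the largest increment of `duelCount`, attained when `i = j`.
  set K : ℝ≥0∞ := ENNReal.ofReal (4 * α * Real.log N / Δ ^ 2) + 2 with hK
  set ind : A → Memory A → ℝ≥0∞ := fun b M => if Bad P α a b M then 1 else 0
  have hstep : ∀ M : Memory A, M.rounds + 1 ≤ N →
      ev (step P α M) (fun M' => max (duelCount M' i j : ℝ≥0∞) K) ≤
        max (duelCount M i j : ℝ≥0∞) K + 2 * ∑ b ∈ Finset.univ.erase a, ind b M := by
    intro M hMN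
    refine ev_le_of_support _ fun M' hM' => ?_
    obtain ⟨s, hs, x, rfl⟩ := mem_support_step hM'
    rw [duelCount_select_update hs]
    by_cases hbad : ∃ b, b ≠ a ∧ Bad P α a b M
    · obtain ⟨b, hba, hb⟩ := hbad
      have h1 : (1 : ℝ≥0∞) ≤ ∑ b ∈ Finset.univ.erase a, ind b M := by
        refine le_trans ?_ (Finset.single_le_sum (f := fun b => ind b M) (fun _ _ => zero_le)
          (Finset.mem_erase.2 ⟨hba, Finset.mem_univ b⟩))
        simp [ind, hb]
      have h2 : (duelCount M i j + ((if s.1 = (i, j) then 1 else 0) +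
          if s.1 = (j, i) then 1 else 0) : ℕ) ≤ duelCount M i j + 2 := by
        split_ifs <;> omega
      refine max_le ((Nat.cast_le.2 h2).trans ?_) ((le_max_right _ _).trans le_self_add)
      push_cast
      refine add_le_add (le_max_left _ _) ?_
      calc (2 : ℝ≥0∞) = 2 * 1 := (mul_one _).symm
        _ ≤ _ := by gcongr
    · push Not at hbad
      refine le_trans ?_ le_self_add
      refine max_le ?_ (le_max_right _ _)
      by_cases h1 : s.1 = (i, j) ∨ s.1 = (j, i)
      · refine le_trans ?_ (le_max_right _ _)
        have hne : s.1 ≠ (a, a) := by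
          rintro h
          rw [h] at h1
          rcases h1 with h1 | h1
          · exact hij h1.symm
          · rw [Prod.mk.injEq] at h1
            exact hij (by rw [← h1.1, ← h1.2])
        have h2 := duelCount_le_of_mem_support_select hα hΔ hgap hbad hs hne
        have h3 : duelCount M s.1.1 s.1.2 = duelCount M i j := by
          rcases h1 with h1 | h1
          · rw [h1]
          · rw [h1]; exact add_comm _ _
        rw [h3] at h2
        have h4 : (duelCount M i j : ℝ≥0∞) ≤ ENNReal.ofReal (4 * α * Real.log N / Δ ^ 2) := by
          rw [← ENNReal.ofReal_natCast]
          refine ENNReal.ofReal_le_ofReal (h2.trans ?_)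
          gcongr
          exact_mod_cast hMN
        rw [hK, Nat.cast_add]
        refine add_le_add h4 ?_
        have : ((if s.1 = (i, j) then 1 else 0) + if s.1 = (j, i) then 1 else 0 : ℕ) ≤ 2 := by
          split_ifs <;> omega
        exact_mod_cast this
      · push Not at h1
        simp [h1.1, h1.2]
  have main : ∀ n ≤ N, ev (run P α n)
      (fun M => max (duelCount M i j : ℝ≥0∞) K) ≤
        K + 2 * ∑ b ∈ Finset.univ.erase a, ∑ t ∈ Finset.range n,
          ev (run P α t) (ind b) := by
    intro n
    induction n with
    | zero => intro _; simp [run_zero, ev_pure, duelCount]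
    | succ n ih =>
      intro hn
      rw [run_succ, ev_bind]
      refine (ev_mono_support _ fun M hM =>
        hstep M (by rw [(run_invariant n M hM).1]; exact hn)).trans ?_
      rw [ev_add, ev_mul_left, ev_sum]
      refine (add_le_add_left (ih (by omega)) _).trans ?_
      simp only [Finset.sum_range_succ, Finset.sum_add_distrib, mul_add, add_assoc]
      exact le_rfl
  exact (ev_mono _ fun M => le_max_left _ K).trans (main N le_rfl)

end RUCB

/-! ### Concentration of the estimates of the Condorcet winner -/

/-- Hoeffding's lemma for a Bernoulli variable. -/
theorem bernoulli_hoeffding {p : ℝ} (h0 : 0 ≤ p) (h1 : p ≤ 1) (l : ℝ) :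
    p * Real.exp (-l * (1 - p) - l ^ 2 / 8) + (1 - p) * Real.exp (l * p - l ^ 2 / 8) ≤ 1 := by
  open MeasureTheory ProbabilityTheory in
  let μ : Measure ℝ := ENNReal.ofReal p • Measure.dirac 1 + ENNReal.ofReal (1 - p) • Measure.dirac 0
  have hμ : IsProbabilityMeasure μ := ⟨by
    simp [μ, ← ENNReal.ofReal_add h0 (sub_nonneg.2 h1)]⟩
  have hint : ∀ f : ℝ → ℝ, ∫ x, f x ∂μ = p * f 1 + (1 - p) * f 0 := by
    intro f
    have hi : ∀ (c : ℝ) (x : ℝ), Integrable f (ENNReal.ofReal c • Measure.dirac x) := fun c x =>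
      (integrable_dirac (by simp)).smul_measure ENNReal.ofReal_ne_top
    rw [integral_add_measure (hi _ _) (hi _ _), integral_smul_measure, integral_smul_measure,
      integral_dirac, integral_dirac, ENNReal.toReal_ofReal h0,
      ENNReal.toReal_ofReal (sub_nonneg.2 h1)]
    rfl
  have hb : ∀ᵐ x ∂μ, (fun x : ℝ => x) x ∈ Set.Icc (0 : ℝ) 1 := by
    have hm : MeasurableSet {x : ℝ | x ∈ Set.Icc (0 : ℝ) 1} := measurableSet_Icc
    rw [ae_add_measure_iff]
    constructor <;> refine Measure.ae_smul_measure ?_ _ <;> rw [ae_dirac_iff hm] <;> simp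
  have h := (hasSubgaussianMGF_of_mem_Icc (X := fun x : ℝ => x) (by fun_prop) hb).mgf_le (-l)
  rw [mgf, hint, hint] at h
  have e1 : ((((‖(1 : ℝ) - 0‖₊ / 2) ^ 2 : NNReal) : ℝ)) * (-l) ^ 2 / 2 = l ^ 2 / 8 := by
    simp; ring
  rw [e1] at h
  have h2 := mul_le_mul_of_nonneg_right h (Real.exp_nonneg (-(l ^ 2 / 8)))
  rw [← Real.exp_add, add_neg_cancel, Real.exp_zero, add_mul, mul_assoc, mul_assoc, ← Real.exp_add,
    ← Real.exp_add] at h2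
  refine le_trans (le_of_eq ?_) h2
  congr 3 <;> congr 1 <;> ring

namespace RUCB

variable {A : Type} [Fintype A] [DecidableEq A] [Nonempty A]

/-- The exponential supermartingale of the duels between `a` and `j`. -/
def expWeight (P : PreferenceMatrix A) (a j : A) (l : ℝ) (M : Memory A) : ℝ :=
  Real.exp (M.wins a j * (-l * (1 - P.prob a j) - l ^ 2 / 8) +
    M.wins j a * (l * P.prob a j - l ^ 2 / 8))

theorem ev_duel (P : PreferenceMatrix A) (e : A × A) (f : Bool → ℝ≥0∞) :
    ev (P.duel e) f = ENNReal.ofReal (P.prob e.1 e.2) * f true +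
      ENNReal.ofReal (P.prob e.2 e.1) * f false := by
  simp [ev, PreferenceMatrix.duel]

theorem wins_next (α : ℝ) (M : Memory A) (e : A × A) (x : Bool) (i j : A) :
    (next α M e x).wins i j =
      M.wins i j + if (i, j) = (if x then (e.1, e.2) else (e.2, e.1)) then 1 else 0 := rfl

/-- Given the selected pair, the weight either stays put or is multiplied by a factor whose mean is
at most `1` by Hoeffding's lemma. The rule of selection is irrelevant, so adaptive sampling does no
harm. -/
theorem ev_step_expWeight_le (P : PreferenceMatrix A) (α : ℝ) {a j : A} (haj : j ≠ a) (l : ℝ)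
    (M : Memory A) : ev (step P α M) (fun M' => ENNReal.ofReal (expWeight P a j l M')) ≤
      ENNReal.ofReal (expWeight P a j l M) := by
  have hp0 := P.prob_nonneg a j
  have hp1 := P.prob_nonneg j a
  have hq : P.prob j a = 1 - P.prob a j := by linarith [P.prob_add a j]
  have hH := bernoulli_hoeffding hp0 (by linarith) l
  have hW : 0 ≤ expWeight P a j l M := Real.exp_nonneg _
  simp only [step_eq, ev_bind, ev_pure]
  refine ev_le_of_support _ fun s hs => ?_
  have hw := (wins_rounds_of_mem_support_select hs).1
  have hwin : ∀ N : Memory A, N.wins a j = M.wins a j + 1 → N.wins j a = M.wins j a →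
      expWeight P a j l N =
        expWeight P a j l M * Real.exp (-l * (1 - P.prob a j) - l ^ 2 / 8) := by
    intro N h1 h2
    rw [expWeight, expWeight, ← Real.exp_add, h1, h2]
    push_cast; congr 1; ring
  have hloss : ∀ N : Memory A, N.wins a j = M.wins a j → N.wins j a = M.wins j a + 1 →
      expWeight P a j l N =
        expWeight P a j l M * Real.exp (l * P.prob a j - l ^ 2 / 8) := by
    intro N h1 h2
    rw [expWeight, expWeight, ← Real.exp_add, h1, h2]
    push_cast; congr 1; ring
  have hfin : ENNReal.ofReal (P.prob a j) * ENNReal.ofReal (expWeight P a j l M *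
        Real.exp (-l * (1 - P.prob a j) - l ^ 2 / 8)) +
      ENNReal.ofReal (P.prob j a) * ENNReal.ofReal (expWeight P a j l M *
        Real.exp (l * P.prob a j - l ^ 2 / 8)) ≤ ENNReal.ofReal (expWeight P a j l M) := by
    rw [← ENNReal.ofReal_mul hp0, ← ENNReal.ofReal_mul hp1,
      ← ENNReal.ofReal_add (by positivity) (by positivity), hq]
    refine ENNReal.ofReal_le_ofReal ?_
    have := mul_le_mul_of_nonneg_left hH hW
    linarith
  by_cases h1 : s.1 = (a, j)
  · rw [ev_duel, h1]
    rw [hwin (next α s.2 (a, j) true) (by simp [wins_next, hw]) (by simp [wins_next, hw, haj]),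
      hloss (next α s.2 (a, j) false) (by simp [wins_next, hw, haj.symm]) (by simp [wins_next, hw])]
    exact hfin
  · by_cases h2 : s.1 = (j, a)
    · rw [ev_duel, h2]
      rw [hloss (next α s.2 (j, a) true) (by simp [wins_next, hw, haj.symm])
          (by simp [wins_next, hw]),
        hwin (next α s.2 (j, a) false) (by simp [wins_next, hw]) (by simp [wins_next, hw, haj]),
        add_comm]
      exact hfin
    · refine ev_le_of_support _ fun x _ => le_of_eq ?_
      have h3 : ∀ c d, s.1 ≠ (c, d) → s.1 ≠ (d, c) →
          (next α s.2 s.1 x).wins c d = M.wins c d := by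
        intro c d h h'
        rw [wins_next, hw, if_neg, add_zero]
        cases x
        · intro h4
          simp only [Bool.false_eq_true, if_false, Prod.mk.injEq] at h4
          exact h' (Prod.ext h4.2.symm h4.1.symm)
        · intro h4
          exact h h4.symm
      rw [expWeight, expWeight, h3 a j h1 h2, h3 j a h2 h1]

theorem ev_run_expWeight_le (P : PreferenceMatrix A) (α : ℝ) {a j : A} (haj : j ≠ a) (l : ℝ)
    (n : ℕ) : ev (run P α n) (fun M => ENNReal.ofReal (expWeight P a j l M)) ≤ 1 := by
  induction n with
  | zero => simp [run_zero, ev_pure, expWeight]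
  | succ n ih =>
    rw [run_succ, ev_bind]
    exact (ev_mono _ fun M => ev_step_expWeight_le P α haj l M).trans ih

/-- The tilt that fits numbers of duels between `b ^ (2 * i)` and `b ^ (2 * (i + 1))`. -/
def tilt (b α L : ℝ) (i : ℕ) : ℝ := 8 / (1 + b) * √(α * L) / b ^ i

/-- If the estimate of `a` against `j` is too small, then one of the exponential weights is
large. -/
theorem exists_expWeight_ge {P : PreferenceMatrix A} {α b : ℝ} (hα : 0 ≤ α) (hb : 1 < b)
    {a j : A} (haj : j ≠ a) {M : Memory A} (hM : Bad P α a j M)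
    (hN : duelCount M a j ≤ M.rounds) :
    ∃ i ∈ Finset.range (⌊Real.log (M.rounds + 1) / (2 * Real.log b)⌋₊ + 1),
      ((M.rounds : ℝ) + 1) ^ (α * (8 * b / (1 + b) ^ 2)) ≤
        expWeight P a j (tilt b α (Real.log (M.rounds + 1)) i) M := by
  have hp1 : P.prob a j ≤ 1 := by linarith [P.prob_add a j, P.prob_nonneg j a]
  set L := Real.log (M.rounds + 1) with hL
  have hL0 : 0 ≤ L := Real.log_nonneg (by simp)
  set p := P.prob a j with hp
  have hlogb : 0 < Real.log b := Real.log_pos hb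
  have hb0 : 0 < b := by linarith
  unfold Bad at hM
  rw [ucb, if_neg haj.symm] at hM
  have hne : duelCount M a j ≠ 0 := by
    intro h0
    have h1 : (M.wins a j : ℝ) + M.wins j a = 0 := by exact_mod_cast h0
    simp only [divOne, h1, if_true] at hM
    have := Real.sqrt_nonneg (1 : ℝ)
    linarith
  have hN0 : (0 : ℝ) < duelCount M a j := Nat.cast_pos.2 (Nat.pos_of_ne_zero hne)
  set N : ℝ := ((duelCount M a j : ℕ) : ℝ) with hNdef
  have hNeq : (M.wins a j : ℝ) + M.wins j a = N := by simp [hNdef, duelCount]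
  rw [hNeq] at hM
  simp only [divOne, hN0.ne', if_false] at hM
  -- the deviation
  have hdev : M.wins a j - p * N < -(√(α * L) * √N) := by
    have h1 := mul_lt_mul_of_pos_right hM hN0
    rw [add_mul, div_mul_cancel₀ _ hN0.ne', Real.sqrt_div (by positivity)] at h1
    have h2 : √(α * L) / √N * N = √(α * L) * √N := by
      rw [div_mul_eq_mul_div, div_eq_iff (Real.sqrt_pos.2 hN0).ne', mul_assoc,
        Real.mul_self_sqrt hN0.le]
    rw [h2] at h1
    linarith
  have hN1 : (1 : ℝ) ≤ N := Nat.one_le_cast.2 (Nat.one_le_iff_ne_zero.2 hne)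
  -- Peeling: the ideal tilt depends on the random `N`, so one tilt serves each slice from `b ^ (2 *
  -- i)` to `b ^ (2 * (i + 1))`.
  obtain ⟨i, hi1, hi2⟩ := exists_nat_pow_near (x := N) (y := b ^ 2) hN1 (by nlinarith)
  refine ⟨i, ?_, ?_⟩
  · rw [Finset.mem_range, Nat.lt_succ_iff, Nat.le_floor_iff (by positivity),
      le_div_iff₀ (by positivity), hL]
    have h1 : (b ^ 2) ^ i ≤ (M.rounds : ℝ) + 1 := by
      have : N ≤ M.rounds := Nat.cast_le.2 hN
      linarith
    have h2 := Real.log_le_log (by positivity) h1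
    rw [← pow_mul, Real.log_pow] at h2
    push_cast at h2
    linarith
  · rw [Real.rpow_def_of_pos (by positivity), expWeight]
    refine Real.exp_le_exp.2 ?_
    rw [← hL, ← hp]
    set l := tilt b α L i with hl
    have e1 : (M.wins a j : ℝ) * (-l * (1 - p) - l ^ 2 / 8) + M.wins j a * (l * p - l ^ 2 / 8) =
        -l * (M.wins a j - p * N) - l ^ 2 / 8 * N := by
      rw [← hNeq]; ring
    rw [e1]
    have hl0 : 0 ≤ l := by rw [hl, tilt]; positivity
    have h1 : l * (√(α * L) * √N) ≤ -l * (M.wins a j - p * N) := by nlinarith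
    set y := √N / b ^ i with hy
    have hbi : 0 < b ^ i := by positivity
    have hyN : √N = y * b ^ i := by rw [hy, div_mul_cancel₀ _ hbi.ne']
    have hNy : N = (y * b ^ i) ^ 2 := by rw [← hyN, Real.sq_sqrt hN0.le]
    have hy1 : 1 ≤ y := by
      rw [hy, le_div_iff₀ hbi, one_mul]
      refine Real.le_sqrt_of_sq_le ?_
      rw [← pow_mul, mul_comm, pow_mul]; exact hi1
    have hy2 : y ≤ b := by
      rw [hy, div_le_iff₀ hbi, ← pow_succ']
      refine Real.sqrt_le_iff.2 ⟨by positivity, ?_⟩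
      rw [← pow_mul, mul_comm, pow_mul]; exact hi2.le
    have hs : √(α * L) ^ 2 = α * L := Real.sq_sqrt (by positivity)
    have e2 : l * (√(α * L) * √N) - l ^ 2 / 8 * N =
        α * L * (8 / (1 + b) * y - 8 / (1 + b) ^ 2 * y ^ 2) := by
      rw [hyN, hNy, hl, tilt]
      generalize √(α * L) = w at hs
      rw [← hs]
      field_simp
    -- The right side is concave in `y`, and the factor `8 / (1 + b)` in `tilt` makes its values at
    -- `y = 1` and `y = b` equal. The common value tends to the optimal `2` as `b` tends to `1`.
    have h2 : 8 * b / (1 + b) ^ 2 ≤ 8 / (1 + b) * y - 8 / (1 + b) ^ 2 * y ^ 2 := by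
      have e3 : 8 / (1 + b) * y - 8 / (1 + b) ^ 2 * y ^ 2 =
          8 * ((1 + b) * y - y ^ 2) / (1 + b) ^ 2 := by field_simp
      rw [e3]
      gcongr
      nlinarith [mul_nonneg (sub_nonneg.2 hy1) (sub_nonneg.2 hy2)]
    have h3 := mul_le_mul_of_nonneg_left h2 (mul_nonneg hα hL0)
    nlinarith

open Classical in
-- Markov's inequality for each of the weights, whose means are at most `1`, and a union bound over
-- the slices. At fixed `t` all tilts are deterministic.
theorem ev_run_bad_le (P : PreferenceMatrix A) {α b : ℝ} (hα : 0 ≤ α) (hb : 1 < b)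
    {a j : A} (haj : j ≠ a) (t : ℕ) :
    ev (run P α t) (fun M => if Bad P α a j M then 1 else 0) ≤
      ENNReal.ofReal ((Real.log (t + 1) / (2 * Real.log b) + 1) *
        ((t : ℝ) + 1) ^ (-(α * (8 * b / (1 + b) ^ 2)))) := by
  set q := α * (8 * b / (1 + b) ^ 2)
  set J := ⌊Real.log (t + 1) / (2 * Real.log b)⌋₊ with hJ
  set c : ℝ≥0∞ := ENNReal.ofReal (((t : ℝ) + 1) ^ (-q))
  have hlogb : 0 < Real.log b := Real.log_pos hb
  have hL0 : 0 ≤ Real.log ((t : ℝ) + 1) := Real.log_nonneg (by simp)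
  calc _ ≤ ev (run P α t) (fun M => c * ∑ i ∈ Finset.range (J + 1),
            ENNReal.ofReal (expWeight P a j (tilt b α (Real.log (t + 1)) i) M)) :=
        ev_mono_support _ fun M hM => ?_
    _ ≤ c * ∑ i ∈ Finset.range (J + 1), 1 := by
        rw [ev_mul_left, ev_sum]
        gcongr with i _
        exact ev_run_expWeight_le P α haj _ t
    _ ≤ _ := ?_
  · obtain ⟨h1, h2⟩ := run_invariant t M hM
    split_ifs with hbad
    · obtain ⟨i, hi, h⟩ := exists_expWeight_ge hα hb haj hbad (by rw [h1]; exact h2 a j haj.symm)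
      rw [h1] at hi h
      refine le_trans ?_ (mul_le_mul_right (Finset.single_le_sum (f := fun i =>
        ENNReal.ofReal (expWeight P a j (tilt b α (Real.log (t + 1)) i) M))
        (fun _ _ => zero_le) hi) c)
      refine le_trans ?_ (mul_le_mul_right (ENNReal.ofReal_le_ofReal h) c)
      rw [← ENNReal.ofReal_mul (by positivity), ← Real.rpow_add (by positivity),
        show -q + α * (8 * b / (1 + b) ^ 2) = 0 from neg_add_cancel q]
      simp
    · exact zero_le
  · rw [Finset.sum_const, Finset.card_range, nsmul_eq_mul, mul_one, ← ENNReal.ofReal_natCast,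
      ← ENNReal.ofReal_mul (by positivity), mul_comm]
    refine ENNReal.ofReal_le_ofReal ?_
    refine mul_le_mul_of_nonneg_right ?_ (by positivity)
    push_cast
    have := Nat.floor_le (a := Real.log ((t : ℝ) + 1) / (2 * Real.log b)) (by positivity)
    rw [hJ]
    linarith

open Classical in
/-- The expected number of steps in which the estimate of the Condorcet winner is too small is
bounded by a constant that depends only on `α`. -/
theorem exists_sum_ev_run_bad_le {α : ℝ} (hα : 1 / 2 < α) :
    ∃ c : ℝ, 0 ≤ c ∧ ∀ (A : Type) [Fintype A] [DecidableEq A] [Nonempty A]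
      (P : PreferenceMatrix A) (a j : A), j ≠ a → ∀ N : ℕ,
        ∑ t ∈ Finset.range N, ev (run P α t) (fun M => if Bad P α a j M then 1 else 0) ≤
          ENNReal.ofReal c := by
  -- For `b = 1 + d` and `α ≥ 1/2 + d` one has `8 α b ≥ 4 + 12 d + 8 d² > (2 + d)²`.
  obtain ⟨b, hb, hq⟩ : ∃ b : ℝ, 1 < b ∧ 1 < α * (8 * b / (1 + b) ^ 2) := by
    have hd0 : 0 < min 1 (α - 1 / 2) := lt_min one_pos (by linarith)
    set d := min 1 (α - 1 / 2)
    have hd1 : d ≤ 1 := min_le_left _ _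
    have hd2 : d ≤ α - 1 / 2 := min_le_right _ _
    refine ⟨1 + d, by linarith, ?_⟩
    rw [← mul_div_assoc, lt_div_iff₀ (by positivity)]
    nlinarith
  set q := α * (8 * b / (1 + b) ^ 2)
  have hlogb : 0 < Real.log b := Real.log_pos hb
  set F : ℕ → ℝ := fun t =>
    (Real.log (t + 1) / (2 * Real.log b) + 1) * ((t : ℝ) + 1) ^ (-q) with hF
  have hL0 : ∀ t : ℕ, 0 ≤ Real.log ((t : ℝ) + 1) := fun t => Real.log_nonneg (by simp)
  have hF0 : ∀ t, 0 ≤ F t := fun t => by have := hL0 t; positivity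
  have hsum : Summable F := by
    -- Half of the excess of `q` over `1` pays for the logarithm, and `ε - q < -1` remains summable.
    set ε := (q - 1) / 2 with hε
    have hε0 : 0 < ε := by rw [hε]; linarith
    have h1 : Summable fun t : ℕ => ((t : ℝ) + 1) ^ (ε - q) := by
      have h := (summable_nat_add_iff 1).2
        (Real.summable_nat_rpow (p := ε - q) |>.2 (by rw [hε]; linarith))
      simpa using h
    refine Summable.of_nonneg_of_le hF0 (fun t => ?_) (h1.mul_left (1 / (ε * (2 * Real.log b)) + 1))
    have ht : (0 : ℝ) < t + 1 := by positivity
    have h2 := Real.log_le_rpow_div ht.le hε0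
    have h3 : (1 : ℝ) ≤ ((t : ℝ) + 1) ^ ε := Real.one_le_rpow (by simp) hε0.le
    rw [sub_eq_add_neg, Real.rpow_add ht, ← mul_assoc, hF]
    refine mul_le_mul_of_nonneg_right ?_ (by positivity)
    rw [add_mul, one_mul]
    refine add_le_add ?_ h3
    calc Real.log ((t : ℝ) + 1) / (2 * Real.log b)
        ≤ ((t : ℝ) + 1) ^ ε / ε / (2 * Real.log b) := by gcongr
      _ = _ := by field_simp
  refine ⟨∑' t, F t, tsum_nonneg hF0, fun A _ _ _ P a j haj N => ?_⟩
  calc _ ≤ ∑ t ∈ Finset.range N, ENNReal.ofReal (F t) := Finset.sum_le_sum fun t _ =>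
        ev_run_bad_le P (by linarith) hb haj t
    _ = ENNReal.ofReal (∑ t ∈ Finset.range N, F t) :=
        (ENNReal.ofReal_sum_of_nonneg fun t _ => hF0 t).symm
    _ ≤ _ := ENNReal.ofReal_le_ofReal (hsum.sum_le_tsum _ fun t _ => hF0 t)

end RUCB

/-! ### Plays of a suboptimal pair under QuACK with RUCB -/

namespace RUCB

/-- The number of plays of a suboptimal pair by a network that follows RUCB. -/
theorem exists_ev_plays_le {α : ℝ} (hα : 1 / 2 < α) (A : Type) [Fintype A] [DecidableEq A]
    [Nonempty A] : ∃ c : ℝ, 0 ≤ c ∧ ∀ (P : PreferenceMatrix A) (a : A) (Δ : ℝ), 0 < Δ →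
      (∀ b, b ≠ a → Δ ≤ P.gap a b) → ∀ (m : ℕ) (G : SimpleGraph (Fin m)), G.Connected →
        ∀ (v : Fin m) (n : ℕ) (e : A × A), e ≠ (a, a) →
          ev (quack (rucb A α) P G v n) (fun s => ((∑ w, s.plays e w : ℕ) : ℝ≥0∞)) ≤
            ENNReal.ofReal (4 * α * Real.log ((m : ℝ) * n) / Δ ^ 2 + c +
              3 * ∑ w, (G.dist v w : ℝ)) := by
  obtain ⟨c, hc0, hc⟩ := exists_sum_ev_run_bad_le hα
  -- The summand `2` is the largest increment of the count in a step; the rest charges `2` for each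
  -- failure against each of at most `Fintype.card A` opponents.
  refine ⟨2 + 2 * (Fintype.card A * c), by positivity, ?_⟩
  rintro P a Δ hΔ hgap m G hG v n ⟨i, j⟩ hij
  have hL : 0 ≤ Real.log ((m : ℝ) * n) := by exact_mod_cast Real.log_natCast_nonneg (m * n)
  have hα0 : 0 ≤ α := by linarith
  have h1 := ev_plays_le (P := P) (π := rucb A α) hG v (e := (i, j))
    (φ := fun M : Memory A => duelCount M i j) (fun M s hs x => by
      have := duelCount_select_update (α := α) (M := M) hs x i j
      change duelCount M i j + _ ≤ duelCount (next α s.2 s.1 x) i j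
      rw [this]
      omega) n
  refine h1.trans ?_
  have h2 := ev_duelCount_le (P := P) hα0 hΔ hgap hij (m * n)
  have h3 : ∑ b ∈ Finset.univ.erase a, ∑ t ∈ Finset.range (m * n),
      ev (run P α t) (fun M => open Classical in if Bad P α a b M then 1 else 0) ≤
        ENNReal.ofReal (Fintype.card A * c) := by
    refine (Finset.sum_le_sum fun b hb => hc A P a b (Finset.ne_of_mem_erase hb) (m * n)).trans ?_
    rw [Finset.sum_const, nsmul_eq_mul, ENNReal.ofReal_mul (by positivity),
      ENNReal.ofReal_natCast]
    gcongr
    exact Finset.card_le_univ _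
  calc _ ≤ ENNReal.ofReal (4 * α * Real.log ((m : ℝ) * n) / Δ ^ 2) + 2 +
        2 * ENNReal.ofReal (Fintype.card A * c) + ((3 * ∑ w, G.dist v w : ℕ) : ℝ≥0∞) := by
        gcongr
        refine h2.trans ?_
        push_cast
        gcongr
    _ = _ := by
        rw [← ENNReal.ofReal_natCast, ← ENNReal.ofReal_ofNat 2, ← ENNReal.ofReal_mul (by norm_num),
          ← ENNReal.ofReal_add (by positivity) (by norm_num),
          ← ENNReal.ofReal_add (by positivity) (by positivity),
          ← ENNReal.ofReal_add (by positivity) (by positivity)]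
        push_cast
        congr 1; ring

end RUCB

namespace PreferenceMatrix

variable {A : Type}

theorem gap_self (P : PreferenceMatrix A) (a : A) : P.gap a a = 0 := by
  have := P.prob_add a a
  unfold gap; linarith

theorem gap_le_half (P : PreferenceMatrix A) (a b : A) : P.gap a b ≤ 1 / 2 := by
  have := P.prob_add a b
  have := P.prob_nonneg b a
  unfold gap; linarith

theorem IsCondorcetWinner.gap_pos {P : PreferenceMatrix A} {a b : A} (h : P.IsCondorcetWinner a)
    (hb : b ≠ a) : 0 < P.gap a b := sub_pos.2 (h b hb)

end PreferenceMatrix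

end Duel

end

/-! ### From plays to group regret -/

theorem mainTheorem4 (k : ℕ) [NeZero k] (α : ℝ) (hα : 1 / 2 < α) (ρ : ℝ) :
    ∃ C : ℝ, 0 < C ∧
      ∀ (P : Duel.PreferenceMatrix (Fin k)) (a : Fin k), P.IsCondorcetWinner a →
        (∀ b c, b ≠ a → c ≠ a → P.gap a b ≤ ρ * P.gap a c) →
        ∀ (m : ℕ) (G : SimpleGraph (Fin m)), G.Connected →
          ∀ (v : Fin m) (n : ℕ), 2 ≤ m * n →
            Duel.groupRegret (Duel.rucb (Fin k) α) P a G v n ≤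
              ENNReal.ofReal (C *
                ((∑ b ∈ Finset.univ.erase a, Real.log ((m : ℝ) * n) / P.gap a b) +
                  (∑ w, (G.dist v w : ℝ)) * ∑ b ∈ Finset.univ.erase a, P.gap a b)) := by
  obtain ⟨c, hc0, hc⟩ := Duel.RUCB.exists_ev_plays_le hα (Fin k)
  have hα0 : 0 < α := by linarith
  -- There are `k * k` pairs, and the three summands pay for the logarithmic term, the constant term
  -- and the delays. For `k = 1` the number `ρ` is unconstrained and may be negative, whence `|ρ|`.
  refine ⟨k * k * (4 * α * |ρ| + c + 3), ?_, ?_⟩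
  · have : (0 : ℝ) < k := Nat.cast_pos.2 (Nat.pos_of_ne_zero (NeZero.ne k))
    positivity
  intro P a ha hρ m G hG v n hmn
  set D : ℝ := ∑ w, (G.dist v w : ℝ) with hD
  have hD0 : 0 ≤ D := Finset.sum_nonneg fun _ _ => Nat.cast_nonneg _
  set L := Real.log ((m : ℝ) * n) with hL
  set S₁ := ∑ b ∈ Finset.univ.erase a, L / P.gap a b with hS₁
  set S₂ := ∑ b ∈ Finset.univ.erase a, P.gap a b with hS₂
  -- This is where `2 ≤ m * n` enters: with gaps at most `1/2`, it keeps `S₁` above `1/2`, so that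
  -- `S₁` dominates `g` and absorbs the constant `c`.
  have hL2 : 1 / 2 ≤ L := by
    have h1 : Real.log 2 ≤ L := Real.log_le_log (by norm_num) (by exact_mod_cast hmn)
    linarith [Real.log_two_gt_d9]
  have hgap0 : ∀ b, 0 ≤ P.gap a b := fun b => by
    by_cases hb : b = a
    · rw [hb, P.gap_self]
    · exact (ha.gap_pos hb).le
  have hS₁0 : 0 ≤ S₁ := Finset.sum_nonneg fun b _ => div_nonneg (by linarith) (hgap0 b)
  have hS₂0 : 0 ≤ S₂ := Finset.sum_nonneg fun b _ => hgap0 b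
  have hgapS₂ : ∀ b, P.gap a b ≤ S₂ := fun b => by
    by_cases hb : b = a
    · rw [hb, P.gap_self]; exact hS₂0
    · exact Finset.single_le_sum (f := fun b => P.gap a b) (fun b _ => hgap0 b)
        (Finset.mem_erase.2 ⟨hb, Finset.mem_univ b⟩)
  -- one pair
  have key : ∀ e : Fin k × Fin k, ENNReal.ofReal (P.pairGap a e) *
      Duel.ev (Duel.quack (Duel.rucb (Fin k) α) P G v n)
        (fun s => ((∑ w, s.plays e w : ℕ) : ENNReal)) ≤
      ENNReal.ofReal ((4 * α * |ρ| + c + 3) * (S₁ + D * S₂)) := by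
    intro e
    by_cases he : e = (a, a)
    · rw [he]
      simp [Duel.PreferenceMatrix.pairGap, P.gap_self]
    obtain ⟨b₁, hb₁⟩ : ∃ b, b ≠ a := by
      by_contra! h
      exact he (Prod.ext (h e.1) (h e.2))
    obtain ⟨b, hb, hmin⟩ := Finset.exists_min_image (Finset.univ.erase a) (fun b => P.gap a b)
      ⟨b₁, Finset.mem_erase.2 ⟨hb₁, Finset.mem_univ _⟩⟩
    have hba := Finset.ne_of_mem_erase hb
    have hΔ := ha.gap_pos hba
    set Δ := P.gap a b with hΔdef
    have h1 := hc P a Δ hΔ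
      (fun b' hb' => hmin b' (Finset.mem_erase.2 ⟨hb', Finset.mem_univ _⟩)) m G hG v n e he
    refine (mul_le_mul_right h1 _).trans ?_
    have hpg0 : 0 ≤ P.pairGap a e := by
      unfold Duel.PreferenceMatrix.pairGap; linarith [hgap0 e.1, hgap0 e.2]
    rw [← ENNReal.ofReal_mul hpg0]
    refine ENNReal.ofReal_le_ofReal ?_
    rw [← hL, ← hD]
    set g := P.pairGap a e with hg
    have hgS : g ≤ S₂ := by
      rw [hg, Duel.PreferenceMatrix.pairGap]; linarith [hgapS₂ e.1, hgapS₂ e.2]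
    have hg2 : g ≤ 1 / 2 := by
      rw [hg, Duel.PreferenceMatrix.pairGap]
      linarith [P.gap_le_half a e.1, P.gap_le_half a e.2]
    have hgρ : g ≤ |ρ| * Δ := by
      have : ∀ b', P.gap a b' ≤ |ρ| * Δ := fun b' => by
        by_cases hb' : b' = a
        · rw [hb', P.gap_self]; positivity
        · exact (hρ b' b hb' hba).trans (mul_le_mul_of_nonneg_right (le_abs_self ρ) hΔ.le)
      rw [hg, Duel.PreferenceMatrix.pairGap]; linarith [this e.1, this e.2]
    have hLS : L / Δ ≤ S₁ := Finset.single_le_sum (f := fun b => L / P.gap a b)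
      (fun b _ => div_nonneg (by linarith) (hgap0 b)) hb
    have h2 : 1 / 2 ≤ S₁ := by
      refine le_trans ?_ hLS
      rw [le_div_iff₀ hΔ]
      have := P.gap_le_half a b
      linarith
    have h3 : g * (4 * α * L / Δ ^ 2) ≤ 4 * α * |ρ| * S₁ := by
      calc g * (4 * α * L / Δ ^ 2) ≤ |ρ| * Δ * (4 * α * L / Δ ^ 2) := by
            have : 0 ≤ L := by linarith
            gcongr
        _ = 4 * α * |ρ| * (L / Δ) := by field_simp
        _ ≤ _ := by gcongr
    have h4 : g * c ≤ c * S₁ := by nlinarith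
    have h5 : g * (3 * D) ≤ 3 * (D * S₂) := by nlinarith
    have h6 : 0 ≤ D * S₂ := mul_nonneg hD0 hS₂0
    have h7 : 0 ≤ (4 * α * |ρ| + c) * (D * S₂) := by positivity
    nlinarith
  unfold Duel.groupRegret
  refine (Finset.sum_le_sum fun e _ => key e).trans (le_of_eq ?_)
  rw [Finset.sum_const, Finset.card_univ, nsmul_eq_mul, ← ENNReal.ofReal_natCast,
    ← ENNReal.ofReal_mul (Nat.cast_nonneg _)]
  congr 1
  simp only [Fintype.card_prod, Fintype.card_fin]
  push_cast
  ring
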